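/- Let $d\ge 1$ and consider the Markov chain $X_t=(\xi_t,Y_t)$ on the half-strip $S=\{0,1,2,\dots\}\times\{1,\dots,d\}$ with layers $L_n=\{n\}\times\{1,\dots,d\}$. From layer $n\ge1$ it moves to layer $n+1$, $n-1$, $n$ with the $d\times d$ blocks of transition probabilities $P_n$, $Q_n$, $R_n$ respectively, where $(P_n+Q_n+R_n)\mathbf 1=\mathbf 1$; from layer $0$ it always moves to layer $1$, according to a stochastic matrix $P_0$. Let $\breve P$ be its transition matrix. Assume that: ($C_1$) $\|R_n+P_n\|<1$ and $\|R_n+Q_n\|<1$ for all $n\ge1$, where $\|\cdot\|$ is the maximal absolute row sum; ($C_2$) $\sum_i P_n(i,j)>0$ for all $n\ge0$ and all $j$, and $\sum_i Q_n(i,j)>0$ for all $n\ge1$ and all $j$; ($C_3$) the states of layer $0$ communicate. Fix a stochastic $d\times d$ matrix $\rho$. For $a\ge1$ put $\zeta^-_{a,a}=\rho$ and $\zeta^-_{n,a}=(I-P_n\zeta^-_{n+1,a}-R_n)^{-1}Q_n$ for $1\le n<a$, and let $\zeta_n^-=\lim_{a\to\infty}\zeta^-_{n,a}$, taken as the entrywise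 lower limit (that it is a limit is part of the assertion). For $n\ge1$ put $$\widetilde u_n^-=(I-P_n\zeta_{n+1}^--R_n)^{-1},\qquad A_n^-=\widetilde u_n^-P_n,\qquad \mathbf u_n^-=\widetilde u_n^-\mathbf 1,$$ $$\varrho_1^+=\mathbf 1'P_0\Big(\sum_{k\ge1}A_1^-\cdots A_{k-1}^-\mathbf u_k^-\Big)+d\in[0,\infty].$$ The censored matrix on $L_0$ is $\breve P^{(L_0)}=\breve P_{00}+\breve P_{01}\big(\sum_{k\ge0}\breve P_{11}^{\,k}\big)\breve P_{10}$, where the $\breve P_{ij}$ are the blocks of $\breve P$ along the partition of $S$ into $L_0$ and $S\setminus L_0$. Let $\breve\mu_0$ be a censored measure, that is, a probability vector on layer $0$ with $\breve\mu_0\breve P^{(L_0)}=\breve\mu_0$. **Theorem.** If $\varrho_1^+<\infty$, then the entrywise lower limits $\zeta^-_n$ ($n\ge1$) are limits, and the chain has exactly one stationary distribution $\{\nu_n\}_{n\ge0}$. It is given by $$\nu_n=\frac{\breve\mu_0P_0A_1^-A_2^-\cdots A_{n-1}^-\widetilde u_n^-}{\varrho^+}\quad(n>0),\qquad \nu_0=\frac{\breve\mu_0}{\varrho^+},$$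 where $$\varrho^+=\breve\mu_0P_0\Big(\sum_{k\ge1}A_1^-\cdots A_{k-1}^-\mathbf u_k^-\Big)+\breve\mu_0\mathbf 1 .$$ Moreover $\varrho^+\le\varrho_1^+<\infty$, with $\varrho^+<\varrho_1^+$ if $d\ge2$, and $\varrho^+=E_{\breve\mu_0}(T_0^+)$ is the mean of the first return time $T_0^+=\inf\{t\ge1:X_t\in L_0\}$ for the walk started from layer $0$ with distribution $\breve\mu_0$. -/

import Mathlib

open scoped ENNReal Matrix
open Filter

/-- Transition blocks of a reflecting, level-dependent random walk on the half-strip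
`{0, 1, 2, …} × {1, …, d}`. In layer `n ≥ 1` the blocks `P n`, `Q n`, `R n` are the probabilities
of a step to layer `n + 1`, `n - 1`, `n`; in layer `0` every step goes to layer `1`, according to
the stochastic matrix `P 0`. The values `Q 0`, `R 0` are never used. -/
structure StripWalk (d : ℕ) where
  P : ℕ → Matrix (Fin d) (Fin d) ℝ
  Q : ℕ → Matrix (Fin d) (Fin d) ℝ
  R : ℕ → Matrix (Fin d) (Fin d) ℝ
  P_zero_stochastic : P 0 ∈ Matrix.rowStochastic ℝ (Fin d)
  P_nonneg : ∀ n, 1 ≤ n → ∀ i j, 0 ≤ P n i j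
  Q_nonneg : ∀ n, 1 ≤ n → ∀ i j, 0 ≤ Q n i j
  R_nonneg : ∀ n, 1 ≤ n → ∀ i j, 0 ≤ R n i j
  row_sum : ∀ n, 1 ≤ n → (P n + Q n + R n) *ᵥ 1 = 1

namespace StripWalk

variable {d : ℕ} (W : StripWalk d)

/-- The transition probabilities of the walk on the half-strip. -/
def step : ℕ × Fin d → ℕ × Fin d → ℝ
  | (0, i), (m, j) => if m = 1 then W.P 0 i j else 0
  | (n + 1, i), (m, j) =>
      if m = n + 2 then W.P (n + 1) i j
      else if m = n + 1 then W.R (n + 1) i j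
      else if m = n then W.Q (n + 1) i j
      else 0

section

attribute [local instance] Matrix.linftyOpNormedAddCommGroup

/-- The standing conditions on the walk. The norm is the maximal absolute row sum, and
`log (1 - x)⁻¹ < ∞` means `x < 1`. -/
structure ConditionC : Prop where
  norm_up : ∀ n, 1 ≤ n → ‖W.R n + W.P n‖ < 1
  norm_down : ∀ n, 1 ≤ n → ‖W.R n + W.Q n‖ < 1
  col_up : ∀ n j, 0 < ∑ i, W.P n i j
  col_down : ∀ n, 1 ≤ n → ∀ j, 0 < ∑ i, W.Q n i j
  layer_zero : ∀ i j : Fin d,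
    Relation.ReflTransGen (fun x y => 0 < W.step x y) (0, i) (0, j)

end

/-- `W.zetaTrunc ρ n m` is the matrix `ζ⁻_{n, n + m}`: it is `ρ` for `m = 0`, and
`ζ⁻_{n, a} = (I - P_n ζ⁻_{n + 1, a} - R_n)⁻¹ Q_n` for `n < a = n + m`. -/
noncomputable def zetaTrunc (ρ : Matrix (Fin d) (Fin d) ℝ) : ℕ → ℕ → Matrix (Fin d) (Fin d) ℝ
  | _, 0 => ρ
  | n, m + 1 => (1 - W.P n * zetaTrunc ρ (n + 1) m - W.R n)⁻¹ * W.Q n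

/-- The limit `ζ⁻_n` of `ζ⁻_{n, a}` as `a → ∞`, written as the entrywise lower limit: the entries
of `ζ⁻_{n, a}` lie in `[0, 1]`, so that this is defined whether or not the sequence converges, and
is the limit whenever it does. -/
noncomputable def zeta (ρ : Matrix (Fin d) (Fin d) ℝ) (n : ℕ) : Matrix (Fin d) (Fin d) ℝ :=
  Matrix.of fun i j => liminf (fun m => W.zetaTrunc ρ n m i j) atTop

/-- The matrix `ũ⁻_n = (I - P_n ζ⁻_{n + 1} - R_n)⁻¹`. -/
noncomputable def uTilde (ρ : Matrix (Fin d) (Fin d) ℝ) (n : ℕ) : Matrix (Fin d) (Fin d) ℝ :=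
  (1 - W.P n * W.zeta ρ (n + 1) - W.R n)⁻¹

/-- The matrix `A⁻_n = (I - P_n ζ⁻_{n + 1} - R_n)⁻¹ P_n`. -/
noncomputable def A (ρ : Matrix (Fin d) (Fin d) ℝ) (n : ℕ) : Matrix (Fin d) (Fin d) ℝ :=
  W.uTilde ρ n * W.P n

/-- The vector `u⁻_n = (I - P_n ζ⁻_{n + 1} - R_n)⁻¹ 1`. -/
noncomputable def u (ρ : Matrix (Fin d) (Fin d) ℝ) (n : ℕ) : Fin d → ℝ :=
  W.uTilde ρ n *ᵥ 1

/-- The product `A⁻_1 A⁻_2 ⋯ A⁻_k` (the identity for `k = 0`). -/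
noncomputable def prodA (ρ : Matrix (Fin d) (Fin d) ℝ) : ℕ → Matrix (Fin d) (Fin d) ℝ
  | 0 => 1
  | k + 1 => prodA ρ k * W.A ρ (k + 1)

/-- The vector `∑_{k ≥ 1} A⁻_1 ⋯ A⁻_{k - 1} u⁻_k`, with entries in `[0, ∞]`. -/
noncomputable def sumAu (ρ : Matrix (Fin d) (Fin d) ℝ) (j : Fin d) : ℝ≥0∞ :=
  ∑' k : ℕ, ENNReal.ofReal ((W.prodA ρ k *ᵥ W.u ρ (k + 1)) j)

/-- The quantity `ϱ⁺ = μ P_0 (∑_{k ≥ 1} A⁻_1 ⋯ A⁻_{k - 1} u⁻_k) + μ 1`. -/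
noncomputable def varrho (ρ : Matrix (Fin d) (Fin d) ℝ) (μ : Fin d → ℝ) : ℝ≥0∞ :=
  ∑ j, ENNReal.ofReal ((μ ᵥ* W.P 0) j) * W.sumAu ρ j + ENNReal.ofReal (∑ i, μ i)

/-- The quantity `ϱ⁺_1 = 1' P_0 (∑_{k ≥ 1} A⁻_1 ⋯ A⁻_{k - 1} u⁻_k) + d`. -/
noncomputable def varrhoOne (ρ : Matrix (Fin d) (Fin d) ℝ) : ℝ≥0∞ :=
  ∑ j, ENNReal.ofReal (((1 : Fin d → ℝ) ᵥ* W.P 0) j) * W.sumAu ρ j + (d : ℝ≥0∞)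

end StripWalk

open Classical in
/-- Powers of a nonnegative matrix with arbitrary index set. -/
noncomputable def infMatrixPow {T : Type*} (q : T → T → ℝ≥0∞) : ℕ → T → T → ℝ≥0∞
  | 0 => fun x y => if x = y then 1 else 0
  | k + 1 => fun x y => ∑' z, infMatrixPow q k x z * q z y

/-- The fundamental matrix `∑_{k ≥ 0} q ^ k`. -/
noncomputable def fundamentalMatrix {T : Type*} (q : T → T → ℝ≥0∞) (x y : T) : ℝ≥0∞ :=
  ∑' k : ℕ, infMatrixPow q k x y

/-- The censored matrix of a transition matrix `p` with censoring set `B`: for the block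
decomposition of `p` along `B` and its complement, it is the `B`-block plus
`U * (fundamental matrix of the complementary block) * D`. -/
noncomputable def censoredMatrix {S : Type*} (p : S → S → ℝ≥0∞) (B : Set S) (i j : B) : ℝ≥0∞ :=
  p i j + ∑' x : ↥Bᶜ, ∑' y : ↥Bᶜ,
    p i x * fundamentalMatrix (fun a b : ↥Bᶜ => p a b) x y * p y j

namespace StripWalk

variable {d : ℕ} (W : StripWalk d)

/-- The `d × d` censored matrix of the walk, with censoring set the layer `0`. -/
noncomputable def censored (i j : Fin d) : ℝ≥0∞ :=
  censoredMatrix (fun x y => ENNReal.ofReal (W.step x y)) {x : ℕ × Fin d | x.1 = 0}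
    ⟨(0, i), rfl⟩ ⟨(0, j), rfl⟩

/-- `μ` is a probability distribution on layer `0` that is a censored measure of the walk. -/
structure IsCensoredDistribution (μ : Fin d → ℝ) : Prop where
  nonneg : ∀ i, 0 ≤ μ i
  sum_eq_one : ∑ i, μ i = 1
  invariant : ∀ j, ∑ i, ENNReal.ofReal (μ i) * W.censored i j = ENNReal.ofReal (μ j)

/-- `ν` is a stationary distribution of the walk: `ν n i` is the mass of the state `(n, i)`. -/
structure IsStationaryDistribution (ν : ℕ → Fin d → ℝ) : Prop where
  nonneg : ∀ n i, 0 ≤ ν n i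
  total : HasSum (fun x : ℕ × Fin d => ν x.1 x.2) 1
  stationary : ∀ y : ℕ × Fin d,
    HasSum (fun x : ℕ × Fin d => ν x.1 x.2 * W.step x y) (ν y.1 y.2)

/-- `X` is the walk, on the probability space `(Ω, ℙ)`, started from layer `0` with initial
distribution `μ`: a Markov chain with transition probabilities `W.step`. -/
structure IsWalkFrom {Ω : Type*} [MeasurableSpace Ω] (ℙ : MeasureTheory.Measure Ω)
    (X : ℕ → Ω → ℕ × Fin d) (μ : Fin d → ℝ) : Prop where
  measurable : ∀ t, Measurable (X t)
  law : ∀ (t : ℕ) (x : ℕ → ℕ × Fin d),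
    ℙ {ω | ∀ s ≤ t, X s ω = x s} =
      ENNReal.ofReal ((if (x 0).1 = 0 then μ (x 0).2 else 0) *
        ∏ s ∈ Finset.range t, W.step (x s) (x (s + 1)))

end StripWalk

/-- The first return time `T⁺_0 = inf {t ≥ 1 : X_t ∈ L_0}` to layer `0` (`∞` if there is none). -/
noncomputable def returnTime {d : ℕ} {Ω : Type*} (X : ℕ → Ω → ℕ × Fin d) (ω : Ω) : ℝ≥0∞ :=
  ⨅ (t : ℕ) (_ : 1 ≤ t ∧ (X t ω).1 = 0), (t : ℝ≥0∞)

/-! The defect `1 - ζ_n 1` of the lower limit is the obstacle: Fatou makes `ζ_n` only substochastic,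
and the recursion passes to the lower limit only as `ζ_n ≥ Q_n + R_n ζ_n + P_n ζ_{n+1} ζ_n`. The
resolvent turns this into `ũ_n Q_n ≤ ζ_n`, so that the defect at `n` is at most `A_n` times the
defect at `n + 1` (`defect_le`). Hence `A_1 ⋯ A_k (1 - ζ_{k+1} 1)` increases with `k`. It is bounded
by `A_1 ⋯ A_k 1 ≤ A_1 ⋯ A_k u_{k+1}`, the general term of a convergent series, so it vanishes.
Positive column sums then give `ζ_n 1 = 1` (`zeta_mulVec_one`). Equality of row sums upgrades `ũ_n
Q_n ≤ ζ_n` to equality and the lower limits to limits.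

Two measures on the strip are now compared: the weights `μ, μ P_0 ũ_1, μ P_0 A_1 ũ_2, …` and the
expected numbers of visits during an excursion from layer 0. Both solve the balance equations off
layer 0, and the excursion measure is the least solution with its boundary values (`occupation_le`).
Its flow back into layer 0 is `μ` times the censored matrix, that is `μ`; the weights return `μ P_0
ζ_1`, which dominates `μ` and has the same mass, hence equals it. So both measures are invariant,
and their difference is an invariant measure vanishing on layer 0, which irreducibility forces to be
zero (`excursion_eq`). The total mass of the weights is `ϱ⁺`, that of the excursion measure is the
mean return time. Normalizing gives existence; `KernelInvariant.unique` gives uniqueness. -/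

/-! ### Invariant measures of nonnegative kernels -/

section Kernel

variable {S : Type*} (p : S → S → ℝ≥0∞)

/-- A measure that is invariant under the kernel `p`. -/
def KernelInvariant (v : S → ℝ≥0∞) : Prop :=
  ∀ z, ∑' y, v y * p y z = v z

/-- Every state can be reached from every state with positive probability. -/
def KernelIrreducible : Prop :=
  ∀ x y, Relation.ReflTransGen (fun x y => 0 < p x y) x y

open Classical in
/-- The mass distribution at time `t`, started from `m`, of the paths that have avoided `B` at
the times `1, …, t`. -/
noncomputable def taboo (B : Set S) (m : S → ℝ≥0∞) : ℕ → S → ℝ≥0∞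
  | 0 => m
  | t + 1 => fun z => if z ∈ B then 0 else ∑' y, taboo B m t y * p y z

/-- The expected number of visits before the first return to `B`. -/
noncomputable def occupation (B : Set S) (m : S → ℝ≥0∞) (z : S) : ℝ≥0∞ :=
  ∑' t, taboo p B m t z

variable {p}

/-- A state of mass zero receives no flow, so each of its predecessors has mass zero; follow a path
from `y` to `x` backwards. -/
theorem KernelInvariant.eq_zero (hp : KernelIrreducible p) {v : S → ℝ≥0∞}
    (hv : KernelInvariant p v) {x : S} (hx : v x = 0) : v = 0 := by
  funext y
  have h := hp y x
  induction h using Relation.ReflTransGen.head_induction_on with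
  | refl => exact hx
  | @head a b hab _ ih =>
    have h1 := (hv b).trans ih
    have h2 := ENNReal.tsum_eq_zero.1 h1 a
    exact (mul_eq_zero.1 h2).resolve_right hab.ne'

theorem KernelInvariant.sub {v w : S → ℝ≥0∞} (hv : KernelInvariant p v)
    (hw : KernelInvariant p w) (hle : w ≤ v) (hfin : ∀ z, w z ≠ ⊤) :
    KernelInvariant p (fun z => v z - w z) := by
  intro z
  have h : ∑' y, (v y - w y) * p y z + ∑' y, w y * p y z = ∑' y, v y * p y z := by
    rw [← ENNReal.tsum_add]
    refine tsum_congr fun y => ?_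
    rw [← add_mul, tsub_add_cancel_of_le (hle y)]
  rw [hv z, hw z] at h
  exact ENNReal.eq_sub_of_add_eq (hfin z) h

theorem ENNReal.eq_of_le_of_tsum_eq {ι : Type*} {f g : ι → ℝ≥0∞} (h : f ≤ g)
    (hs : ∑' i, f i = ∑' i, g i) (hfin : ∑' i, f i ≠ ⊤) : f = g := by
  have h1 : ∑' i, (g i - f i) + ∑' i, f i = ∑' i, g i := by
    rw [← ENNReal.tsum_add]
    exact tsum_congr fun y => tsub_add_cancel_of_le (h y)
  rw [← hs] at h1
  have h2 : ∑' i, (g i - f i) = 0 := by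
    have := ENNReal.eq_sub_of_add_eq hfin h1
    simpa using this
  funext i
  exact le_antisymm (h i) (tsub_eq_zero_iff_le.1 (ENNReal.tsum_eq_zero.1 h2 i))

theorem tsum_kernel_eq (hrow : ∀ x, ∑' y, p x y = 1) (v : S → ℝ≥0∞) :
    ∑' z, ∑' y, v y * p y z = ∑' y, v y := by
  rw [ENNReal.tsum_comm]
  refine tsum_congr fun y => ?_
  rw [ENNReal.tsum_mul_left, hrow, mul_one]

/-- The minimum is subinvariant by monotonicity. Row sums one preserve its total mass, which is
finite, so no inequality can be strict. -/
theorem KernelInvariant.inf (hrow : ∀ x, ∑' y, p x y = 1) {v w : S → ℝ≥0∞}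
    (hv : KernelInvariant p v) (hw : KernelInvariant p w) (hfin : ∑' x, v x ≠ ⊤) :
    KernelInvariant p (fun z => min (v z) (w z)) := by
  have hle : (fun z => ∑' y, min (v y) (w y) * p y z) ≤ fun z => min (v z) (w z) := by
    intro z
    refine le_min ?_ ?_
    · rw [← hv z]
      exact ENNReal.tsum_le_tsum fun y => mul_le_mul_left (min_le_left _ _) _
    · rw [← hw z]
      exact ENNReal.tsum_le_tsum fun y => mul_le_mul_left (min_le_right _ _) _
  have hs := tsum_kernel_eq hrow (fun z => min (v z) (w z))
  refine fun z => congrFun (ENNReal.eq_of_le_of_tsum_eq hle hs ?_) z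
  rw [hs]
  exact ne_top_of_le_ne_top hfin (ENNReal.tsum_le_tsum fun y => min_le_left _ _)

/-- An irreducible kernel has at most one invariant probability distribution. -/
theorem KernelInvariant.unique (hp : KernelIrreducible p) (hrow : ∀ x, ∑' y, p x y = 1)
    {v w : S → ℝ≥0∞} (hv : KernelInvariant p v) (hw : KernelInvariant p w)
    (hfin : ∑' x, v x ≠ ⊤) (hs : ∑' x, v x = ∑' x, w x) : v = w := by
  have hm := hv.inf hrow hw hfin
  have hmfin : ∀ z, min (v z) (w z) ≠ ⊤ := fun z =>
    ne_top_of_le_ne_top (ENNReal.ne_top_of_tsum_ne_top hfin z) (min_le_left _ _)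
  -- At such an `x` the invariant measure `v - min v w` vanishes, so `v ≤ w` everywhere; otherwise
  -- `w < v` everywhere. Equal finite masses settle both cases.
  by_cases h : ∃ x, v x ≤ w x
  · obtain ⟨x, hx⟩ := h
    have h0 := (hv.sub hm (fun z => min_le_left _ _) hmfin).eq_zero hp (x := x)
      (by simp [hx])
    refine ENNReal.eq_of_le_of_tsum_eq (fun z => ?_) hs hfin
    have := tsub_eq_zero_iff_le.1 (congrFun h0 z)
    exact this.trans (min_le_right _ _)
  · push Not at h
    exact (ENNReal.eq_of_le_of_tsum_eq (fun z => (h z).le) hs.symm (hs ▸ hfin)).symm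

/-! ### Excursions from a set and the censored matrix -/

section Taboo

variable {B : Set S} {m : S → ℝ≥0∞}

theorem occupation_of_mem {z : S} (hz : z ∈ B) : occupation p B m z = m z := by
  rw [occupation, tsum_eq_zero_add' ENNReal.summable]
  simp [taboo, hz]

theorem occupation_of_notMem (hm : ∀ z, z ∉ B → m z = 0) {z : S} (hz : z ∉ B) :
    occupation p B m z = ∑' y, occupation p B m y * p y z := by
  simp only [occupation, ← ENNReal.tsum_mul_right]
  rw [tsum_eq_zero_add' ENNReal.summable, ENNReal.tsum_comm]
  simp [taboo, hz, hm z hz]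

/-- Minimality of the occupation measure among supersolutions: off `B`, the partial sum over `n + 1`
times is the partial sum over `n` times pushed once through the kernel, so a bound by `v` persists.
-/
theorem occupation_le (hm : ∀ z, z ∉ B → m z = 0) {v : S → ℝ≥0∞} (hmv : ∀ z, m z ≤ v z)
    (hv : ∀ z, z ∉ B → ∑' y, v y * p y z ≤ v z) (z : S) : occupation p B m z ≤ v z := by
  have key : ∀ n : ℕ, ∀ z, ∑ t ∈ Finset.range n, taboo p B m t z ≤ v z := by
    intro n
    induction n with
    | zero => simp
    | succ n ih =>
      intro z
      rw [Finset.sum_range_succ']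
      by_cases hz : z ∈ B
      · simpa [taboo, hz] using hmv z
      · simp only [taboo, hz, if_false, hm z hz, add_zero]
        refine le_trans ?_ (hv z hz)
        rw [← Summable.tsum_finsetSum fun _ _ => ENNReal.summable]
        refine ENNReal.tsum_le_tsum fun y => ?_
        rw [← Finset.sum_mul]
        exact mul_le_mul_left (ih y) _
  rw [occupation, ENNReal.tsum_eq_iSup_nat]
  exact iSup_le fun n => key n z

theorem tsum_eq_tsum_subtype {f : S → ℝ≥0∞} (hf : ∀ z, z ∉ B → f z = 0) :
    ∑' z, f z = ∑' z : B, f z := by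
  rw [tsum_subtype]
  refine tsum_congr fun z => ?_
  by_cases hz : z ∈ B <;> simp [hz, hf]

/-- A path that avoids `B` at times `1, …, k + 1` leaves `B` at its first step and then makes `k`
steps inside the complement. -/
theorem taboo_succ_eq (hm : ∀ z, z ∉ B → m z = 0) (k : ℕ) (z : ↥Bᶜ) :
    taboo p B m (k + 1) z = ∑' i : B, ∑' x : ↥Bᶜ,
      m i * p i x * infMatrixPow (fun a b : ↥Bᶜ => p a b) k x z := by
  have hz : (z : S) ∉ B := z.2
  induction k generalizing z with
  | zero =>
    simp only [taboo, hz, if_false, infMatrixPow]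
    rw [tsum_eq_tsum_subtype (B := B) (fun y hy => by simp [hm y hy])]
    refine tsum_congr fun i => ?_
    rw [tsum_eq_single z (fun b hb => by simp [hb])]
    simp
  | succ k ih =>
    rw [taboo]
    simp only [hz, if_false]
    rw [tsum_eq_tsum_subtype (B := Bᶜ)
      (fun y hy => by simp only [Set.mem_compl_iff, not_not] at hy; simp [taboo, hy])]
    simp only [fun y : ↥Bᶜ => ih y y.2, infMatrixPow, ← ENNReal.tsum_mul_right,
      ← ENNReal.tsum_mul_left]
    rw [ENNReal.tsum_comm]
    refine tsum_congr fun i => ?_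
    rw [ENNReal.tsum_comm]
    simp only [mul_assoc]

/-- Split the flow into `B` by the time of the last state before the return: time 0 yields the
`B`-block, later times yield the detour through the fundamental matrix. -/
theorem tsum_occupation_mul (hm : ∀ z, z ∉ B → m z = 0) (j : B) :
    ∑' z, occupation p B m z * p z j = ∑' i : B, m i * censoredMatrix p B i j := by
  have h1 : ∑' z, occupation p B m z * p z j =
      ∑' z, m z * p z j + ∑' z, (∑' k, taboo p B m (k + 1) z) * p z j := by
    rw [← ENNReal.tsum_add]
    refine tsum_congr fun z => ?_
    rw [occupation, tsum_eq_zero_add' ENNReal.summable, add_mul]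
    rfl
  have h2 : ∑' z, (∑' k, taboo p B m (k + 1) z) * p z j = ∑' i : B, m i *
      ∑' x : ↥Bᶜ, ∑' y : ↥Bᶜ,
        p i x * fundamentalMatrix (fun a b : ↥Bᶜ => p a b) x y * p y j := by
    rw [tsum_eq_tsum_subtype (B := Bᶜ)
      (fun y hy => by simp only [Set.mem_compl_iff, not_not] at hy; simp [taboo, hy])]
    simp only [taboo_succ_eq hm, fundamentalMatrix, ← ENNReal.tsum_mul_right,
      ← ENNReal.tsum_mul_left]
    calc _ = ∑' y : ↥Bᶜ, ∑' i : B, ∑' k : ℕ, ∑' x : ↥Bᶜ, m i * p i x *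
              infMatrixPow (fun a b : ↥Bᶜ => p a b) k x y * p y j :=
            tsum_congr fun y => ENNReal.tsum_comm
      _ = ∑' i : B, ∑' y : ↥Bᶜ, ∑' k : ℕ, ∑' x : ↥Bᶜ, m i * p i x *
              infMatrixPow (fun a b : ↥Bᶜ => p a b) k x y * p y j := ENNReal.tsum_comm
      _ = ∑' i : B, ∑' y : ↥Bᶜ, ∑' x : ↥Bᶜ, ∑' k : ℕ, m i * p i x *
              infMatrixPow (fun a b : ↥Bᶜ => p a b) k x y * p y j :=
            tsum_congr fun i => tsum_congr fun y => ENNReal.tsum_comm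
      _ = ∑' i : B, ∑' x : ↥Bᶜ, ∑' y : ↥Bᶜ, ∑' k : ℕ, m i * p i x *
              infMatrixPow (fun a b : ↥Bᶜ => p a b) k x y * p y j :=
            tsum_congr fun i => ENNReal.tsum_comm
      _ = _ := by simp only [mul_assoc]
  rw [h1, h2, tsum_eq_tsum_subtype (B := B) (f := fun z => m z * p z j)
    (fun y hy => by simp [hm y hy]), ← ENNReal.tsum_add]
  refine tsum_congr fun i => ?_
  rw [censoredMatrix, mul_add]

end Taboo

end Kernel

/-! ### Nonnegative and strictly substochastic matrices -/

section NonnegMatrix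

variable {ι : Type*} [Fintype ι]

theorem Matrix.mul_entry_nonneg {A B : Matrix ι ι ℝ} (hA : ∀ i j, 0 ≤ A i j)
    (hB : ∀ i j, 0 ≤ B i j) (i j : ι) : 0 ≤ (A * B) i j := by
  rw [Matrix.mul_apply]
  exact Finset.sum_nonneg fun k _ => mul_nonneg (hA i k) (hB k j)

theorem Matrix.mul_entry_mono {A A' B B' : Matrix ι ι ℝ} (hA : ∀ i j, 0 ≤ A i j)
    (hB : ∀ i j, 0 ≤ B i j) (hAA' : ∀ i j, A i j ≤ A' i j) (hBB' : ∀ i j, B i j ≤ B' i j)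
    (i j : ι) : (A * B) i j ≤ (A' * B') i j := by
  simp only [Matrix.mul_apply]
  exact Finset.sum_le_sum fun k _ =>
    mul_le_mul (hAA' i k) (hBB' k j) (hB k j) ((hA i k).trans (hAA' i k))

theorem Matrix.mulVec_nonneg' {A : Matrix ι ι ℝ} (hA : ∀ i j, 0 ≤ A i j) {x : ι → ℝ}
    (hx : 0 ≤ x) : 0 ≤ A *ᵥ x :=
  fun i => Finset.sum_nonneg fun k _ => mul_nonneg (hA i k) (hx k)

theorem Matrix.mulVec_mono' {A : Matrix ι ι ℝ} (hA : ∀ i j, 0 ≤ A i j) {x y : ι → ℝ}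
    (hx : x ≤ y) : A *ᵥ x ≤ A *ᵥ y :=
  fun i => Finset.sum_le_sum fun k _ => mul_le_mul_of_nonneg_left (hx k) (hA i k)

theorem Matrix.vecMul_nonneg' {A : Matrix ι ι ℝ} (hA : ∀ i j, 0 ≤ A i j) {x : ι → ℝ}
    (hx : 0 ≤ x) : 0 ≤ x ᵥ* A :=
  fun j => Finset.sum_nonneg fun k _ => mul_nonneg (hx k) (hA k j)

theorem Matrix.colSum_mul_pos {A B : Matrix ι ι ℝ}
    (hB : ∀ i j, 0 ≤ B i j) (hAc : ∀ j, 0 < ∑ i, A i j) (hBc : ∀ j, 0 < ∑ i, B i j) (j : ι) :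
    0 < ∑ i, (A * B) i j := by
  simp only [Matrix.mul_apply]
  rw [Finset.sum_comm]
  simp only [← Finset.sum_mul]
  obtain ⟨k, -, hk⟩ := Finset.exists_lt_of_sum_lt (s := Finset.univ) (f := fun _ : ι => (0 : ℝ))
    (g := fun i => B i j) (by simpa using hBc j)
  exact Finset.sum_pos' (fun i _ => mul_nonneg (hAc i).le (hB i j))
    ⟨k, Finset.mem_univ k, mul_pos (hAc k) hk⟩

theorem Matrix.eq_zero_of_mulVec_eq_zero_of_colSum_pos {A : Matrix ι ι ℝ}
    (hAc : ∀ j, 0 < ∑ i, A i j) {x : ι → ℝ} (hx : 0 ≤ x)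
    (h : A *ᵥ x = 0) : x = 0 := by
  have h1 : ∑ j, (∑ i, A i j) * x j = 0 := by
    have : ∑ i, (A *ᵥ x) i = 0 := by simp [h]
    simp only [Matrix.mulVec, dotProduct] at this
    rw [Finset.sum_comm] at this
    simpa only [Finset.sum_mul] using this
  funext j
  have h2 := (Finset.sum_eq_zero_iff_of_nonneg
    (fun j _ => mul_nonneg (hAc j).le (hx j))).1 h1 j (Finset.mem_univ j)
  exact (mul_eq_zero.1 h2).resolve_left (hAc j).ne'

variable [DecidableEq ι]

/-- A maximum principle for strictly substochastic matrices. -/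
theorem Matrix.nonneg_of_one_sub_mulVec_nonneg {M : Matrix ι ι ℝ} (hM : ∀ i j, 0 ≤ M i j)
    (hrow : ∀ i, ∑ j, M i j < 1) {x : ι → ℝ} (hx : 0 ≤ (1 - M) *ᵥ x) : 0 ≤ x := by
  intro i
  have : Nonempty ι := ⟨i⟩
  -- At a minimizing index `k`, `x k` is at least the row sum of row `k` times `x k`; as that row
  -- sum is below one, `x k` cannot be negative.
  obtain ⟨k, hk⟩ := Finite.exists_min x
  refine le_trans ?_ (hk i)
  have h1 : 0 ≤ x k - ∑ j, M k j * x j := by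
    have := hx k
    rwa [Matrix.sub_mulVec, Matrix.one_mulVec] at this
  have h2 : (∑ j, M k j) * x k ≤ ∑ j, M k j * x j := by
    rw [Finset.sum_mul]
    exact Finset.sum_le_sum fun j _ => mul_le_mul_of_nonneg_left (hk j) (hM k j)
  by_contra hneg
  simp only [Pi.zero_apply, not_le] at hneg
  nlinarith [hrow k]

theorem Matrix.isUnit_det_one_sub {M : Matrix ι ι ℝ} (hM : ∀ i j, 0 ≤ M i j)
    (hrow : ∀ i, ∑ j, M i j < 1) : IsUnit (1 - M).det := by
  rw [← Matrix.isUnit_iff_isUnit_det, ← Matrix.mulVec_injective_iff_isUnit]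
  intro x y hxy
  have key : ∀ x y : ι → ℝ, (1 - M) *ᵥ x = (1 - M) *ᵥ y → x ≤ y := by
    intro x y h
    rw [← sub_nonneg]
    apply Matrix.nonneg_of_one_sub_mulVec_nonneg hM hrow
    rw [Matrix.mulVec_sub, h, sub_self]
  exact le_antisymm (key _ _ hxy) (key _ _ hxy.symm)

theorem Matrix.nonneg_of_one_sub_mul_nonneg {M : Matrix ι ι ℝ} (hM : ∀ i j, 0 ≤ M i j)
    (hrow : ∀ i, ∑ j, M i j < 1) {X : Matrix ι ι ℝ} (hX : ∀ i j, 0 ≤ ((1 - M) * X) i j)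
    (i j : ι) : 0 ≤ X i j :=
  Matrix.nonneg_of_one_sub_mulVec_nonneg hM hrow (x := X.col j) (fun k => hX k j) i

theorem Matrix.inv_one_sub_nonneg {M : Matrix ι ι ℝ} (hM : ∀ i j, 0 ≤ M i j)
    (hrow : ∀ i, ∑ j, M i j < 1) (i j : ι) : 0 ≤ (1 - M)⁻¹ i j := by
  refine Matrix.nonneg_of_one_sub_mul_nonneg hM hrow (fun i j => ?_) i j
  rw [Matrix.mul_nonsing_inv _ (Matrix.isUnit_det_one_sub hM hrow), Matrix.one_apply]
  split_ifs <;> norm_num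

end NonnegMatrix

/-! ### Lower limits through eventual lower bounds -/

section Liminf

theorem le_liminf_of_unit_interval {f : ℕ → ℝ} (h1 : ∀ k, f k ≤ 1) {c : ℝ}
    (hc : ∀ᶠ k in atTop, c ≤ f k) : c ≤ liminf f atTop :=
  le_liminf_of_le (isBoundedUnder_of ⟨1, h1⟩).isCoboundedUnder_ge hc

/-- Replaces superadditivity and supermultiplicativity of the lower limit: inequalities are proved
for the bounds `g m`, kept nonnegative so that they can be multiplied, and then `m → ∞`. -/
theorem exists_tendsto_liminf_of_unit_interval {f : ℕ → ℝ} (h0 : ∀ k, 0 ≤ f k)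
    (h1 : ∀ k, f k ≤ 1) : ∃ g : ℕ → ℝ, (∀ m, 0 ≤ g m) ∧ (∀ m, ∀ᶠ k in atTop, g m ≤ f k) ∧
      Tendsto g atTop (nhds (liminf f atTop)) := by
  have hb : atTop.IsBoundedUnder (· ≥ ·) f := isBoundedUnder_of ⟨0, h0⟩
  have hl : 0 ≤ liminf f atTop := le_liminf_of_unit_interval h1 (.of_forall h0)
  refine ⟨fun m => max 0 (liminf f atTop - 1 / ((m : ℝ) + 1)), fun m => le_max_left _ _,
    fun m => ?_, ?_⟩
  · have := eventually_lt_of_lt_liminf (f := atTop) (u := f)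
      (b := liminf f atTop - 1 / ((m : ℝ) + 1)) (sub_lt_self _ (by positivity)) hb
    filter_upwards [this] with k hk
    exact max_le (h0 k) hk.le
  · have h := (tendsto_const_nhds (x := (0 : ℝ)) (f := atTop)).max
      ((tendsto_const_nhds (x := liminf f atTop)).sub
        (tendsto_one_div_add_atTop_nhds_zero_nat (𝕜 := ℝ)))
    simpa [max_eq_right hl] using h

theorem exists_matrix_tendsto_liminf {ι : Type*} [Finite ι] {F : ℕ → Matrix ι ι ℝ}
    (h0 : ∀ k i j, 0 ≤ F k i j) (h1 : ∀ k i j, F k i j ≤ 1) :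
    ∃ G : ℕ → Matrix ι ι ℝ, (∀ m i j, 0 ≤ G m i j) ∧
      (∀ m, ∀ᶠ k in atTop, ∀ i j, G m i j ≤ F k i j) ∧
      Tendsto G atTop (nhds (Matrix.of fun i j => liminf (fun k => F k i j) atTop)) := by
  choose g hg0 hg1 hg2 using fun i j =>
    exists_tendsto_liminf_of_unit_interval (fun k => h0 k i j) (fun k => h1 k i j)
  refine ⟨fun m => Matrix.of fun i j => g i j m, fun m i j => hg0 i j m, fun m => ?_, ?_⟩
  · exact eventually_all.2 fun i => eventually_all.2 fun j => hg1 i j m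
  · exact tendsto_pi_nhds.2 fun i => tendsto_pi_nhds.2 fun j => hg2 i j

end Liminf

/-! ### Resolvents and the truncated matrices -/

namespace StripWalk

variable {d : ℕ} {W : StripWalk d} {ρ : Matrix (Fin d) (Fin d) ℝ}

section

attribute [local instance] Matrix.linftyOpNormedAddCommGroup

theorem sum_row_lt_one_of_linfty_norm_lt {M : Matrix (Fin d) (Fin d) ℝ} (h : ‖M‖ < 1)
    (i : Fin d) : ∑ j, M i j < 1 := by
  rw [Matrix.linfty_opNorm_def] at h
  have h1 : ∑ j, ‖M i j‖₊ ≤ Finset.univ.sup fun i => ∑ j, ‖M i j‖₊ :=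
    Finset.le_sup (f := fun i => ∑ j, ‖M i j‖₊) (Finset.mem_univ i)
  have h2 : ((∑ j, ‖M i j‖₊ : NNReal) : ℝ) < 1 := lt_of_le_of_lt (NNReal.coe_le_coe.2 h1) h
  refine lt_of_le_of_lt ?_ h2
  push_cast
  exact Finset.sum_le_sum fun j _ => Real.le_norm_self _

theorem ConditionC.sum_up_lt (hC : W.ConditionC) {n : ℕ} (hn : 1 ≤ n) (i : Fin d) :
    ∑ j, (W.R n + W.P n) i j < 1 :=
  sum_row_lt_one_of_linfty_norm_lt (hC.norm_up n hn) i

end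

theorem sum_row_eq_one (W : StripWalk d) {n : ℕ} (hn : 1 ≤ n) (i : Fin d) :
    ∑ j, W.P n i j + ∑ j, W.Q n i j + ∑ j, W.R n i j = 1 := by
  have := congrFun (W.row_sum n hn) i
  simpa [Matrix.mulVec, dotProduct, Finset.sum_add_distrib] using this

theorem P_nonneg' (W : StripWalk d) (n : ℕ) (i j : Fin d) : 0 ≤ W.P n i j := by
  rcases Nat.eq_zero_or_pos n with rfl | hn
  · exact Matrix.nonneg_of_mem_rowStochastic W.P_zero_stochastic
  · exact W.P_nonneg n hn i j

/-- The nonnegative matrices whose row sums are at most one. -/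
structure Substochastic (Z : Matrix (Fin d) (Fin d) ℝ) : Prop where
  nonneg : ∀ i j, 0 ≤ Z i j
  row_le : Z *ᵥ 1 ≤ 1

theorem substochastic_of_mem_rowStochastic (h : ρ ∈ Matrix.rowStochastic ℝ (Fin d)) :
    Substochastic ρ :=
  ⟨fun _ _ => Matrix.nonneg_of_mem_rowStochastic h, (Matrix.mem_rowStochastic.1 h).2.le⟩

section Resolvent

variable {n : ℕ} {Z : Matrix (Fin d) (Fin d) ℝ}

theorem kernel_nonneg (W : StripWalk d) (hn : 1 ≤ n) (hZ : Substochastic Z) (i j : Fin d) :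
    0 ≤ (W.P n * Z + W.R n) i j :=
  add_nonneg (Matrix.mul_entry_nonneg (W.P_nonneg n hn) hZ.nonneg i j) (W.R_nonneg n hn i j)

theorem kernel_row_lt (hC : W.ConditionC) (hn : 1 ≤ n) (hZ : Substochastic Z) (i : Fin d) :
    ∑ j, (W.P n * Z + W.R n) i j < 1 := by
  refine lt_of_le_of_lt ?_ (hC.sum_up_lt hn i)
  have h := Matrix.mulVec_mono' (W.P_nonneg n hn) hZ.row_le i
  rw [Matrix.mulVec_mulVec] at h
  simp only [Matrix.mulVec, dotProduct, Pi.one_apply, mul_one] at h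
  simp only [Matrix.add_apply, Finset.sum_add_distrib]
  linarith

theorem isUnit_det_resolvent (hC : W.ConditionC) (hn : 1 ≤ n) (hZ : Substochastic Z) :
    IsUnit (1 - W.P n * Z - W.R n).det := by
  rw [sub_sub]
  exact Matrix.isUnit_det_one_sub (W.kernel_nonneg hn hZ) (kernel_row_lt hC hn hZ)

theorem resolvent_nonneg (hC : W.ConditionC) (hn : 1 ≤ n) (hZ : Substochastic Z)
    (i j : Fin d) : 0 ≤ (1 - W.P n * Z - W.R n)⁻¹ i j := by
  rw [sub_sub]
  exact Matrix.inv_one_sub_nonneg (W.kernel_nonneg hn hZ) (kernel_row_lt hC hn hZ) i j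

theorem mulVec_one_sub (W : StripWalk d) (hn : 1 ≤ n) :
    (1 - W.P n * Z - W.R n) *ᵥ 1 = W.Q n *ᵥ 1 + W.P n *ᵥ (1 - Z *ᵥ 1) := by
  have h := W.row_sum n hn
  rw [Matrix.add_mulVec, Matrix.add_mulVec] at h
  rw [Matrix.sub_mulVec, Matrix.sub_mulVec, Matrix.one_mulVec, ← Matrix.mulVec_mulVec,
    Matrix.mulVec_sub]
  nth_rw 1 [← h]
  abel

/-- Conservation of mass in one layer: what the resolvent fails to send down is the part sent up and
lost through the defect of `Z`. For stochastic `Z` nothing is lost. -/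
theorem resolvent_mul_Q_mulVec_one (hC : W.ConditionC) (hn : 1 ≤ n) (hZ : Substochastic Z) :
    ((1 - W.P n * Z - W.R n)⁻¹ * W.Q n) *ᵥ 1 =
      1 - ((1 - W.P n * Z - W.R n)⁻¹ * W.P n) *ᵥ (1 - Z *ᵥ 1) := by
  have h := congrArg (fun v => (1 - W.P n * Z - W.R n)⁻¹ *ᵥ v) (W.mulVec_one_sub (Z := Z) hn)
  simp only [Matrix.mulVec_mulVec, Matrix.mulVec_add,
    Matrix.nonsing_inv_mul _ (isUnit_det_resolvent hC hn hZ), Matrix.one_mulVec] at h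
  exact eq_sub_of_add_eq h.symm

end Resolvent

theorem zetaTrunc_stochastic (hC : W.ConditionC) (hρ : ρ ∈ Matrix.rowStochastic ℝ (Fin d))
    (m : ℕ) : ∀ n, 1 ≤ n →
    W.zetaTrunc ρ n m ∈ Matrix.rowStochastic ℝ (Fin d) := by
  induction m with
  | zero => intro n _; simpa [zetaTrunc] using hρ
  | succ m ih =>
    intro n hn
    have hZ := ih (n + 1) (by omega)
    have hs := substochastic_of_mem_rowStochastic hZ
    refine Matrix.mem_rowStochastic.2 ⟨?_, ?_⟩
    · exact Matrix.mul_entry_nonneg (resolvent_nonneg hC hn hs) (W.Q_nonneg n hn)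
    · rw [zetaTrunc, resolvent_mul_Q_mulVec_one hC hn hs, (Matrix.mem_rowStochastic.1 hZ).2]
      simp

end StripWalk

/-! ### The lower limits are stochastic and are limits -/

namespace StripWalk

variable {d : ℕ} {W : StripWalk d} {ρ : Matrix (Fin d) (Fin d) ℝ}

theorem zeta_nonneg (hC : W.ConditionC) (hρ : ρ ∈ Matrix.rowStochastic ℝ (Fin d)) {n : ℕ}
    (hn : 1 ≤ n) (i j : Fin d) : 0 ≤ W.zeta ρ n i j :=
  le_liminf_of_unit_interval
    (fun k => Matrix.le_one_of_mem_rowStochastic (zetaTrunc_stochastic hC hρ k n hn))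
    (.of_forall fun k => Matrix.nonneg_of_mem_rowStochastic (zetaTrunc_stochastic hC hρ k n hn))

/-- The lower limit is approximated from below by matrices that the sequence
`ζ⁻_{n, n + m}` eventually dominates. -/
theorem exists_tendsto_zeta (hC : W.ConditionC) (hρ : ρ ∈ Matrix.rowStochastic ℝ (Fin d)) {n : ℕ}
    (hn : 1 ≤ n) : ∃ G : ℕ → Matrix (Fin d) (Fin d) ℝ, (∀ m i j, 0 ≤ G m i j) ∧
      (∀ m, ∀ᶠ k in atTop, ∀ i j, G m i j ≤ W.zetaTrunc ρ n k i j) ∧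
      Tendsto G atTop (nhds (W.zeta ρ n)) :=
  exists_matrix_tendsto_liminf
    (fun k _ _ => Matrix.nonneg_of_mem_rowStochastic (zetaTrunc_stochastic hC hρ k n hn))
    (fun k _ _ => Matrix.le_one_of_mem_rowStochastic (zetaTrunc_stochastic hC hρ k n hn))

theorem zeta_substochastic (hC : W.ConditionC) (hρ : ρ ∈ Matrix.rowStochastic ℝ (Fin d)) {n : ℕ}
    (hn : 1 ≤ n) : Substochastic (W.zeta ρ n) := by
  refine ⟨zeta_nonneg hC hρ hn, fun i => ?_⟩
  obtain ⟨G, -, hG1, hG2⟩ := exists_tendsto_zeta hC hρ hn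
  have ht : Tendsto (fun m => ∑ j, G m i j) atTop (nhds (∑ j, W.zeta ρ n i j)) :=
    tendsto_finsetSum _ fun j _ => tendsto_pi_nhds.1 (tendsto_pi_nhds.1 hG2 i) j
  have h : ∑ j, W.zeta ρ n i j ≤ 1 := by
    refine le_of_tendsto' ht fun m => ?_
    obtain ⟨k, hk⟩ := (hG1 m).exists
    rw [← Matrix.sum_row_of_mem_rowStochastic (zetaTrunc_stochastic hC hρ k n hn) i]
    exact Finset.sum_le_sum fun j _ => hk i j
  simpa [Matrix.mulVec, dotProduct] using h

theorem zetaTrunc_succ_eq (hC : W.ConditionC) (hρ : ρ ∈ Matrix.rowStochastic ℝ (Fin d)) {n : ℕ}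
    (hn : 1 ≤ n) (k : ℕ) : W.zetaTrunc ρ n (k + 1) = W.Q n + (W.R n * W.zetaTrunc ρ n (k + 1) +
      W.P n * W.zetaTrunc ρ (n + 1) k * W.zetaTrunc ρ n (k + 1)) := by
  have hs := substochastic_of_mem_rowStochastic
    (zetaTrunc_stochastic hC hρ k (n + 1) (by omega))
  have h : (1 - W.P n * W.zetaTrunc ρ (n + 1) k - W.R n) * W.zetaTrunc ρ n (k + 1) = W.Q n := by
    rw [zetaTrunc, ← mul_assoc, Matrix.mul_nonsing_inv _ (isUnit_det_resolvent hC hn hs), one_mul]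
  rw [sub_mul, sub_mul, one_mul] at h
  rw [← h]
  abel

/-- Fatou's lemma for the recursion: all coefficients are nonnegative, so the fixed-point equation
survives in the lower limit as an inequality. -/
theorem le_zeta (hC : W.ConditionC) (hρ : ρ ∈ Matrix.rowStochastic ℝ (Fin d)) {n : ℕ}
    (hn : 1 ≤ n) (i j : Fin d) : (W.Q n + (W.R n * W.zeta ρ n +
      W.P n * W.zeta ρ (n + 1) * W.zeta ρ n)) i j ≤ W.zeta ρ n i j := by
  obtain ⟨G, hG0, hG1, hG2⟩ := exists_tendsto_zeta hC hρ hn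
  obtain ⟨H, hH0, hH1, hH2⟩ := exists_tendsto_zeta hC hρ (n := n + 1) (by omega)
  have ht : Tendsto (fun m => W.Q n + (W.R n * G m + W.P n * H m * G m)) atTop
      (nhds (W.Q n + (W.R n * W.zeta ρ n + W.P n * W.zeta ρ (n + 1) * W.zeta ρ n))) :=
    tendsto_const_nhds.add ((tendsto_const_nhds.mul hG2).add
      ((tendsto_const_nhds.mul hH2).mul hG2))
  refine le_of_tendsto' (tendsto_pi_nhds.1 (tendsto_pi_nhds.1 ht i) j) fun m => ?_
  refine le_liminf_of_unit_interval
    (fun k => Matrix.le_one_of_mem_rowStochastic (zetaTrunc_stochastic hC hρ k n hn)) ?_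
  -- Shift by one: the level `a` is common to `ζ_{n,a}` and `ζ_{n+1,a}`, so depth `k + 1` at `n`
  -- meets depth `k` at `n + 1`.
  rw [← map_add_atTop_eq_nat 1, eventually_map]
  filter_upwards [(tendsto_add_atTop_nat 1).eventually (hG1 m), hH1 m] with k hk1 hk2
  rw [zetaTrunc_succ_eq hC hρ hn k]
  refine add_le_add le_rfl (add_le_add ?_ ?_)
  · exact Matrix.mul_entry_mono (W.R_nonneg n hn) (hG0 m) (fun _ _ => le_rfl) hk1 i j
  · exact Matrix.mul_entry_mono (Matrix.mul_entry_nonneg (W.P_nonneg n hn) (hH0 m)) (hG0 m)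
      (Matrix.mul_entry_mono (W.P_nonneg n hn) (hH0 m) (fun _ _ => le_rfl) hk2) hk1 i j

theorem isUnit_det_zeta (hC : W.ConditionC) (hρ : ρ ∈ Matrix.rowStochastic ℝ (Fin d)) {n : ℕ}
    (hn : 1 ≤ n) : IsUnit (1 - W.P n * W.zeta ρ (n + 1) - W.R n).det :=
  isUnit_det_resolvent hC hn (zeta_substochastic hC hρ (by omega))

theorem uTilde_nonneg (hC : W.ConditionC) (hρ : ρ ∈ Matrix.rowStochastic ℝ (Fin d)) {n : ℕ}
    (hn : 1 ≤ n) (i j : Fin d) : 0 ≤ W.uTilde ρ n i j :=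
  resolvent_nonneg hC hn (zeta_substochastic hC hρ (by omega)) i j

theorem uTilde_eq (hC : W.ConditionC) (hρ : ρ ∈ Matrix.rowStochastic ℝ (Fin d)) {n : ℕ}
    (hn : 1 ≤ n) :
    W.uTilde ρ n = 1 + (W.P n * W.zeta ρ (n + 1) + W.R n) * W.uTilde ρ n := by
  have h := Matrix.mul_nonsing_inv _ (isUnit_det_zeta hC hρ hn)
  rw [← uTilde, sub_sub, sub_mul, one_mul] at h
  rw [← h]
  abel

theorem one_le_uTilde (hC : W.ConditionC) (hρ : ρ ∈ Matrix.rowStochastic ℝ (Fin d)) {n : ℕ}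
    (hn : 1 ≤ n) (i j : Fin d) : (1 : Matrix (Fin d) (Fin d) ℝ) i j ≤ W.uTilde ρ n i j := by
  rw [uTilde_eq hC hρ hn]
  exact le_add_of_nonneg_right (Matrix.mul_entry_nonneg
    (W.kernel_nonneg hn (zeta_substochastic hC hρ (by omega))) (uTilde_nonneg hC hρ hn) i j)

theorem A_nonneg (hC : W.ConditionC) (hρ : ρ ∈ Matrix.rowStochastic ℝ (Fin d)) {n : ℕ}
    (hn : 1 ≤ n) (i j : Fin d) : 0 ≤ W.A ρ n i j :=
  Matrix.mul_entry_nonneg (uTilde_nonneg hC hρ hn) (W.P_nonneg n hn) i j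

theorem A_colSum_pos (hC : W.ConditionC) (hρ : ρ ∈ Matrix.rowStochastic ℝ (Fin d)) {n : ℕ}
    (hn : 1 ≤ n) (j : Fin d) : 0 < ∑ i, W.A ρ n i j := by
  refine lt_of_lt_of_le (hC.col_up n j) (Finset.sum_le_sum fun i _ => ?_)
  have h := Matrix.mul_entry_mono (A := 1) (fun i j => by rw [Matrix.one_apply]; split_ifs <;> simp)
    (W.P_nonneg n hn) (one_le_uTilde hC hρ hn) (fun _ _ => le_rfl) i j
  rwa [one_mul] at h

theorem one_le_u (hC : W.ConditionC) (hρ : ρ ∈ Matrix.rowStochastic ℝ (Fin d)) {n : ℕ}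
    (hn : 1 ≤ n) : 1 ≤ W.u ρ n := by
  intro i
  have h : ∑ j, (1 : Matrix (Fin d) (Fin d) ℝ) i j ≤ ∑ j, W.uTilde ρ n i j :=
    Finset.sum_le_sum fun j _ => one_le_uTilde hC hρ hn i j
  simpa [u, Matrix.mulVec, dotProduct, Matrix.one_apply] using h

theorem prodA_nonneg (hC : W.ConditionC) (hρ : ρ ∈ Matrix.rowStochastic ℝ (Fin d)) (k : ℕ) :
    ∀ i j, 0 ≤ W.prodA ρ k i j := by
  induction k with
  | zero => intro i j; rw [prodA, Matrix.one_apply]; split_ifs <;> simp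
  | succ k ih => exact Matrix.mul_entry_nonneg ih (A_nonneg hC hρ (by omega))

theorem prodA_colSum_pos (hC : W.ConditionC) (hρ : ρ ∈ Matrix.rowStochastic ℝ (Fin d)) (k : ℕ) :
    ∀ j, 0 < ∑ i, W.prodA ρ k i j := by
  induction k with
  | zero => intro j; simp [prodA, Matrix.one_apply]
  | succ k ih =>
    exact Matrix.colSum_mul_pos (A_nonneg hC hρ (by omega)) ih (A_colSum_pos hC hρ (by omega))

/-- `ũ_n Q_n` solves the linear equation of which `ζ_n` is a supersolution by `le_zeta`; the maximum
principle compares the two. -/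
theorem uTilde_mul_Q_le (hC : W.ConditionC) (hρ : ρ ∈ Matrix.rowStochastic ℝ (Fin d)) {n : ℕ}
    (hn : 1 ≤ n) (i j : Fin d) : (W.uTilde ρ n * W.Q n) i j ≤ W.zeta ρ n i j := by
  have hs := zeta_substochastic hC hρ (n := n + 1) (by omega)
  rw [← sub_nonneg, ← Matrix.sub_apply]
  refine Matrix.nonneg_of_one_sub_mul_nonneg (W.kernel_nonneg hn hs) (kernel_row_lt hC hn hs)
    (fun i j => ?_) i j
  have h : (1 - (W.P n * W.zeta ρ (n + 1) + W.R n)) * (W.uTilde ρ n * W.Q n) = W.Q n := by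
    rw [← sub_sub, uTilde, ← mul_assoc, Matrix.mul_nonsing_inv _ (isUnit_det_zeta hC hρ hn),
      one_mul]
  have h2 := le_zeta hC hρ hn i j
  rw [mul_sub, h, sub_mul, one_mul, add_mul]
  simp only [Matrix.sub_apply, Matrix.add_apply] at h2 ⊢
  linarith

/-- The total mass defect of `ζ⁻_n` is controlled by that of `ζ⁻_{n + 1}`. -/
theorem defect_le (hC : W.ConditionC) (hρ : ρ ∈ Matrix.rowStochastic ℝ (Fin d)) {n : ℕ}
    (hn : 1 ≤ n) : 1 - W.zeta ρ n *ᵥ 1 ≤ W.A ρ n *ᵥ (1 - W.zeta ρ (n + 1) *ᵥ 1) := by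
  have hs := zeta_substochastic hC hρ (n := n + 1) (by omega)
  have h : (W.uTilde ρ n * W.Q n) *ᵥ 1 ≤ W.zeta ρ n *ᵥ 1 := fun i => by
    simp only [Matrix.mulVec, dotProduct, Pi.one_apply, mul_one]
    exact Finset.sum_le_sum fun j _ => uTilde_mul_Q_le hC hρ hn i j
  rw [uTilde, resolvent_mul_Q_mulVec_one hC hn hs] at h
  rw [sub_le_comm]
  exact h

/-- The column sums of `P 0` are positive, so an infinite entry would make `ϱ⁺_1` infinite. -/
theorem sumAu_ne_top (hC : W.ConditionC) (hfin : W.varrhoOne ρ < ⊤) (j : Fin d) :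
    W.sumAu ρ j ≠ ⊤ := by
  intro h
  refine hfin.ne ?_
  rw [varrhoOne, ENNReal.add_eq_top, ENNReal.sum_eq_top]
  refine Or.inl ⟨j, Finset.mem_univ j, ?_⟩
  rw [h, ENNReal.mul_top]
  simpa [Matrix.vecMul, dotProduct] using hC.col_up 0 j

theorem tendsto_prodA_mulVec_one (hC : W.ConditionC)
    (hρ : ρ ∈ Matrix.rowStochastic ℝ (Fin d)) (hfin : W.varrhoOne ρ < ⊤) (j : Fin d) :
    Tendsto (fun k => (W.prodA ρ k *ᵥ 1) j) atTop (nhds 0) := by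
  have h := ENNReal.tendsto_atTop_zero_of_tsum_ne_top (sumAu_ne_top hC hfin j)
  have h' : Tendsto (fun k => (W.prodA ρ k *ᵥ W.u ρ (k + 1)) j) atTop (nhds 0) := by
    have h2 := (ENNReal.tendsto_toReal ENNReal.zero_ne_top).comp h
    refine h2.congr fun k => ENNReal.toReal_ofReal ?_
    exact Matrix.mulVec_nonneg' (prodA_nonneg hC hρ k)
      (zero_le_one.trans (one_le_u hC hρ (by omega))) j
  exact squeeze_zero (fun k => Matrix.mulVec_nonneg' (prodA_nonneg hC hρ k) zero_le_one j)
    (fun k => Matrix.mulVec_mono' (prodA_nonneg hC hρ k) (one_le_u hC hρ (by omega)) j) h'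

/-- An increasing nonnegative sequence dominated by one tending to zero is zero. Positive column
sums of `A_1 ⋯ A_k` then let the product be cancelled from the defect. -/
theorem zeta_mulVec_one (hC : W.ConditionC) (hρ : ρ ∈ Matrix.rowStochastic ℝ (Fin d))
    (hfin : W.varrhoOne ρ < ⊤) {n : ℕ} (hn : 1 ≤ n) : W.zeta ρ n *ᵥ 1 = 1 := by
  obtain ⟨k, rfl⟩ : ∃ k, n = k + 1 := ⟨n - 1, by omega⟩
  have hnn : ∀ k, 0 ≤ 1 - W.zeta ρ (k + 1) *ᵥ 1 := fun k =>
    sub_nonneg.2 (zeta_substochastic hC hρ (by omega)).row_le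
  have hmono : Monotone fun k => W.prodA ρ k *ᵥ (1 - W.zeta ρ (k + 1) *ᵥ 1) := by
    refine monotone_nat_of_le_succ fun k => ?_
    rw [prodA, ← Matrix.mulVec_mulVec]
    exact Matrix.mulVec_mono' (prodA_nonneg hC hρ k) (defect_le hC hρ (by omega))
  have hzero : W.prodA ρ k *ᵥ (1 - W.zeta ρ (k + 1) *ᵥ 1) = 0 := by
    refine le_antisymm (fun j => ?_) (Matrix.mulVec_nonneg' (prodA_nonneg hC hρ k) (hnn k))
    refine ge_of_tendsto (tendsto_prodA_mulVec_one hC hρ hfin j) ?_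
    filter_upwards [eventually_ge_atTop k] with m hm
    refine (hmono hm j).trans (Matrix.mulVec_mono' (prodA_nonneg hC hρ m) ?_ j)
    exact sub_le_self _ (Matrix.mulVec_nonneg' (zeta_nonneg hC hρ (by omega)) zero_le_one)
  exact (sub_eq_zero.1 (Matrix.eq_zero_of_mulVec_eq_zero_of_colSum_pos
    (prodA_colSum_pos hC hρ k) (hnn k) hzero)).symm

theorem zeta_row_sum (hC : W.ConditionC) (hρ : ρ ∈ Matrix.rowStochastic ℝ (Fin d))
    (hfin : W.varrhoOne ρ < ⊤) {n : ℕ} (hn : 1 ≤ n) (i : Fin d) : ∑ j, W.zeta ρ n i j = 1 := by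
  simpa [Matrix.mulVec, dotProduct] using congrFun (zeta_mulVec_one hC hρ hfin hn) i

theorem uTilde_mul_Q (hC : W.ConditionC) (hρ : ρ ∈ Matrix.rowStochastic ℝ (Fin d))
    (hfin : W.varrhoOne ρ < ⊤) {n : ℕ} (hn : 1 ≤ n) : W.uTilde ρ n * W.Q n = W.zeta ρ n := by
  have hs := zeta_substochastic hC hρ (n := n + 1) (by omega)
  have h1 : (W.uTilde ρ n * W.Q n) *ᵥ 1 = 1 := by
    rw [uTilde, resolvent_mul_Q_mulVec_one hC hn hs, zeta_mulVec_one hC hρ hfin (by omega)]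
    simp
  ext i j
  refine (Finset.sum_eq_sum_iff_of_le
    (fun j _ => uTilde_mul_Q_le hC hρ hn i j)).1 ?_ j (Finset.mem_univ j)
  rw [zeta_row_sum hC hρ hfin hn]
  simpa [Matrix.mulVec, dotProduct] using congrFun h1 i

/-- No mass is lost in the limit, so lower bounds suffice: an entry of a stochastic row is one minus
the others, and their lower bounds give the upper bound. -/
theorem tendsto_zetaTrunc (hC : W.ConditionC) (hρ : ρ ∈ Matrix.rowStochastic ℝ (Fin d))
    (hfin : W.varrhoOne ρ < ⊤) {n : ℕ} (hn : 1 ≤ n) (i j : Fin d) :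
    Tendsto (fun m => W.zetaTrunc ρ n m i j) atTop (nhds (W.zeta ρ n i j)) := by
  obtain ⟨G, -, hG1, hG2⟩ := exists_tendsto_zeta hC hρ hn
  have hG3 : ∀ j, Tendsto (fun m => G m i j) atTop (nhds (W.zeta ρ n i j)) := fun j =>
    tendsto_pi_nhds.1 (tendsto_pi_nhds.1 hG2 i) j
  have hU : Tendsto (fun m => 1 - ∑ l ∈ Finset.univ.erase j, G m i l) atTop
      (nhds (W.zeta ρ n i j)) := by
    have h := (tendsto_const_nhds (x := (1 : ℝ))).sub
      (tendsto_finsetSum (Finset.univ.erase j) fun l _ => hG3 l)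
    rw [← zeta_row_sum hC hρ hfin hn i, ← Finset.add_sum_erase _ _ (Finset.mem_univ j),
      add_sub_cancel_right] at h
    rwa [← zeta_row_sum hC hρ hfin hn i, ← Finset.add_sum_erase _ _ (Finset.mem_univ j)]
  refine tendsto_order.2 ⟨fun a ha => ?_, fun a ha => ?_⟩
  · obtain ⟨m, hm⟩ := ((hG3 j).eventually (lt_mem_nhds ha)).exists
    filter_upwards [hG1 m] with k hk
    exact hm.trans_le (hk i j)
  · obtain ⟨m, hm⟩ := (hU.eventually (gt_mem_nhds ha)).exists
    filter_upwards [hG1 m] with k hk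
    refine lt_of_le_of_lt ?_ hm
    have h := Matrix.sum_row_of_mem_rowStochastic (zetaTrunc_stochastic hC hρ k n hn) i
    rw [← Finset.add_sum_erase _ _ (Finset.mem_univ j)] at h
    have h2 : ∑ l ∈ Finset.univ.erase j, G m i l ≤
        ∑ l ∈ Finset.univ.erase j, W.zetaTrunc ρ n k i l :=
      Finset.sum_le_sum fun l _ => hk i l
    linarith

end StripWalk

/-! ### The kernel of the walk and its irreducibility -/

namespace StripWalk

variable {d : ℕ} {W : StripWalk d}

/-- The transition kernel of the walk with values in `[0, ∞]`. -/
noncomputable def kernel (W : StripWalk d) (x y : ℕ × Fin d) : ℝ≥0∞ :=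
  ENNReal.ofReal (W.step x y)

theorem step_up (W : StripWalk d) (n : ℕ) (i j : Fin d) :
    W.step (n, i) (n + 1, j) = W.P n i j := by
  cases n <;> simp [step]

theorem step_stay (W : StripWalk d) (n : ℕ) (i j : Fin d) :
    W.step (n + 1, i) (n + 1, j) = W.R (n + 1) i j := by
  simp [step]

theorem step_down (W : StripWalk d) (n : ℕ) (i j : Fin d) :
    W.step (n + 1, i) (n, j) = W.Q (n + 1) i j := by
  simp [step]

theorem step_zero_zero (W : StripWalk d) (i j : Fin d) : W.step (0, i) (0, j) = 0 := by
  simp [step]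

theorem step_far (W : StripWalk d) {m n : ℕ} (i j : Fin d) (h1 : n ≠ m + 1) (h2 : n ≠ m)
    (h3 : m ≠ n + 1) : W.step (m, i) (n, j) = 0 := by
  cases m with
  | zero => simp [step, show n ≠ 1 by omega]
  | succ m => simp [step, show n ≠ m + 2 by omega, h2, show n ≠ m by omega]

theorem step_nonneg (W : StripWalk d) (x y : ℕ × Fin d) : 0 ≤ W.step x y := by
  obtain ⟨m, i⟩ := x
  obtain ⟨n, j⟩ := y
  by_cases h1 : n = m + 1
  · subst h1; rw [step_up]; exact W.P_nonneg' m i j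
  by_cases h2 : n = m
  · subst h2
    cases n with
    | zero => rw [step_zero_zero]
    | succ n => rw [step_stay]; exact W.R_nonneg _ (by omega) i j
  by_cases h3 : m = n + 1
  · subst h3; rw [step_down]; exact W.Q_nonneg _ (by omega) i j
  · rw [step_far W i j h1 h2 h3]

theorem tsum_kernel_zero (W : StripWalk d) (v : ℕ × Fin d → ℝ≥0∞) (j : Fin d) :
    ∑' x, v x * W.kernel x (0, j) = ∑ i, v (1, i) * ENNReal.ofReal (W.Q 1 i j) := by
  rw [ENNReal.summable.tsum_prod' fun _ => ENNReal.summable, tsum_eq_single 1]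
  · simp only [tsum_fintype, kernel]
    exact Finset.sum_congr rfl fun i _ => by rw [← step_down W 0 i j]
  · intro m hm
    rw [ENNReal.tsum_eq_zero]
    intro i
    rcases Nat.eq_zero_or_pos m with rfl | h
    · simp [kernel, step_zero_zero]
    · simp [kernel, step_far W i j (m := m) (n := 0) (by omega) (by omega) (by omega)]

theorem tsum_kernel_succ (W : StripWalk d) (v : ℕ × Fin d → ℝ≥0∞) (n : ℕ) (j : Fin d) :
    ∑' x, v x * W.kernel x (n + 1, j) = ∑ i, v (n, i) * ENNReal.ofReal (W.P n i j) +
      ∑ i, v (n + 1, i) * ENNReal.ofReal (W.R (n + 1) i j) +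
      ∑ i, v (n + 2, i) * ENNReal.ofReal (W.Q (n + 2) i j) := by
  rw [ENNReal.summable.tsum_prod' fun _ => ENNReal.summable,
    tsum_eq_sum (s := {n, n + 1, n + 2})]
  · rw [Finset.sum_insert (by simp), Finset.sum_insert (by simp), Finset.sum_singleton, ← add_assoc]
    simp only [tsum_fintype, kernel, step_up, step_stay, step_down]
  · intro m hm
    simp only [Finset.mem_insert, Finset.mem_singleton, not_or] at hm
    rw [ENNReal.tsum_eq_zero]
    intro i
    simp [kernel, step_far W i j (m := m) (n := n + 1) (by omega) (by omega) (by omega)]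

theorem tsum_kernel_row (W : StripWalk d) (x : ℕ × Fin d) : ∑' y, W.kernel x y = 1 := by
  obtain ⟨n, i⟩ := x
  rw [ENNReal.summable.tsum_prod' fun _ => ENNReal.summable]
  simp only [tsum_fintype, kernel]
  have hsum : ∀ m, ∑ j, ENNReal.ofReal (W.step (n, i) (m, j)) =
      ENNReal.ofReal (∑ j, W.step (n, i) (m, j)) := fun m =>
    (ENNReal.ofReal_sum_of_nonneg fun j _ => W.step_nonneg _ _).symm
  simp only [hsum]
  cases n with
  | zero =>
    rw [tsum_eq_single 1]
    · rw [Finset.sum_congr rfl fun j _ => W.step_up 0 i j,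
        Matrix.sum_row_of_mem_rowStochastic W.P_zero_stochastic i, ENNReal.ofReal_one]
    · intro m hm
      rw [Finset.sum_eq_zero, ENNReal.ofReal_zero]
      intro j _
      simp [step, hm]
  | succ n =>
    -- Listed as up, down, stay, the order of the row-sum identity for `P`, `Q`, `R`.
    rw [tsum_eq_sum (s := {n + 2, n, n + 1})]
    · have h0 : ∀ m, 0 ≤ ∑ j, W.step (n + 1, i) (m, j) := fun m =>
        Finset.sum_nonneg fun j _ => W.step_nonneg _ _
      rw [Finset.sum_insert (by simp), Finset.sum_insert (by simp), Finset.sum_singleton,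
        ← ENNReal.ofReal_add (h0 _) (h0 _), ← ENNReal.ofReal_add (h0 _) (add_nonneg (h0 _) (h0 _)),
        Finset.sum_congr rfl fun j _ => W.step_up (n + 1) i j,
        Finset.sum_congr rfl fun j _ => W.step_stay n i j,
        Finset.sum_congr rfl fun j _ => W.step_down n i j, ← add_assoc,
        W.sum_row_eq_one (by omega) i, ENNReal.ofReal_one]
    · intro m hm
      simp only [Finset.mem_insert, Finset.mem_singleton, not_or] at hm
      rw [Finset.sum_eq_zero, ENNReal.ofReal_zero]
      intro j _
      exact W.step_far i j (by omega) (by omega) (by omega)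

/-- Row sums of `R + P` below one allow a descent from every state; positive column sums of `P` let
every state be reached from layer 0, whose states communicate. -/
theorem kernelIrreducible (hC : W.ConditionC) : KernelIrreducible W.kernel := by
  have hker : ∀ x y, 0 < W.kernel x y ↔ 0 < W.step x y := fun x y => ENNReal.ofReal_pos
  have hdown : ∀ n i, ∃ j, Relation.ReflTransGen (fun x y => 0 < W.step x y) (n, i) (0, j) := by
    intro n
    induction n with
    | zero => exact fun i => ⟨i, .refl⟩
    | succ n ih =>
      intro i
      have h : 0 < ∑ j, W.Q (n + 1) i j := by
        have h1 := hC.sum_up_lt (n := n + 1) (by omega) i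
        have h2 := W.sum_row_eq_one (n := n + 1) (by omega) i
        simp only [Matrix.add_apply, Finset.sum_add_distrib] at h1
        linarith
      obtain ⟨k, -, hk⟩ := Finset.exists_lt_of_sum_lt (s := Finset.univ)
        (f := fun _ : Fin d => (0 : ℝ)) (g := fun j => W.Q (n + 1) i j) (by simpa using h)
      obtain ⟨j, hj⟩ := ih k
      exact ⟨j, .head (by rwa [step_down]) hj⟩
  have hup : ∀ n j, ∃ i, Relation.ReflTransGen (fun x y => 0 < W.step x y) (0, i) (n, j) := by
    intro n
    induction n with
    | zero => exact fun i => ⟨i, .refl⟩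
    | succ n ih =>
      intro j
      obtain ⟨k, -, hk⟩ := Finset.exists_lt_of_sum_lt (s := Finset.univ)
        (f := fun _ : Fin d => (0 : ℝ)) (g := fun i => W.P n i j) (by simpa using hC.col_up n j)
      obtain ⟨i, hi⟩ := ih k
      exact ⟨i, .tail hi (by rwa [step_up])⟩
  rintro ⟨m, i⟩ ⟨n, j⟩
  simp only [hker]
  obtain ⟨k, hk⟩ := hdown m i
  obtain ⟨l, hl⟩ := hup n j
  exact (hk.trans (hC.layer_zero k l)).trans hl

end StripWalk

/-! ### Real sums as extended nonnegative sums; uniqueness -/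

section RealSums

theorem hasSum_iff_tsum_ofReal {ι : Type*} {f : ι → ℝ} (hf : ∀ i, 0 ≤ f i) {a : ℝ} (ha : 0 ≤ a) :
    HasSum f a ↔ ∑' i, ENNReal.ofReal (f i) = ENNReal.ofReal a := by
  constructor
  · intro h
    rw [← h.tsum_eq, ENNReal.ofReal_tsum_of_nonneg hf h.summable]
  · intro h
    have hs : Summable f := by
      have := ENNReal.summable_toReal (f := fun i => ENNReal.ofReal (f i))
        (by rw [h]; exact ENNReal.ofReal_ne_top)
      simpa only [ENNReal.toReal_ofReal (hf _)] using this
    rw [← ENNReal.ofReal_tsum_of_nonneg hf hs,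
      ENNReal.ofReal_eq_ofReal_iff (tsum_nonneg hf) ha] at h
    exact h ▸ hs.hasSum

theorem ENNReal.ofReal_vecMul {ι : Type*} [Fintype ι] {x : ι → ℝ} {M : Matrix ι ι ℝ}
    (hx : 0 ≤ x) (hM : ∀ i j, 0 ≤ M i j) (j : ι) :
    ENNReal.ofReal ((x ᵥ* M) j) = ∑ i, ENNReal.ofReal (x i) * ENNReal.ofReal (M i j) := by
  rw [Matrix.vecMul, dotProduct,
    ENNReal.ofReal_sum_of_nonneg fun i _ => mul_nonneg (hx i) (hM i j)]
  exact Finset.sum_congr rfl fun i _ => ENNReal.ofReal_mul (hx i)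

end RealSums

namespace StripWalk

variable {d : ℕ} {W : StripWalk d}

theorem isStationaryDistribution_iff {ν : ℕ → Fin d → ℝ} :
    W.IsStationaryDistribution ν ↔ (∀ n i, 0 ≤ ν n i) ∧
      ∑' x : ℕ × Fin d, ENNReal.ofReal (ν x.1 x.2) = 1 ∧
      KernelInvariant W.kernel fun x => ENNReal.ofReal (ν x.1 x.2) := by
  have hstat : ∀ (_ : ∀ n i, 0 ≤ ν n i) (y : ℕ × Fin d),
      HasSum (fun x : ℕ × Fin d => ν x.1 x.2 * W.step x y) (ν y.1 y.2) ↔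
      ∑' x : ℕ × Fin d, ENNReal.ofReal (ν x.1 x.2) * W.kernel x y =
        ENNReal.ofReal (ν y.1 y.2) := by
    intro h0 y
    rw [hasSum_iff_tsum_ofReal (fun x => mul_nonneg (h0 _ _) (W.step_nonneg _ _)) (h0 _ _)]
    simp only [ENNReal.ofReal_mul (h0 _ _), kernel]
  constructor
  · rintro ⟨h0, h1, h2⟩
    refine ⟨h0, ?_, fun y => (hstat h0 y).1 (h2 y)⟩
    rw [(hasSum_iff_tsum_ofReal (fun x => h0 _ _) zero_le_one).1 h1, ENNReal.ofReal_one]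
  · rintro ⟨h0, h1, h2⟩
    refine ⟨h0, (hasSum_iff_tsum_ofReal (fun x => h0 _ _) zero_le_one).2 ?_,
      fun y => (hstat h0 y).2 (h2 y)⟩
    rw [h1, ENNReal.ofReal_one]

theorem IsStationaryDistribution.unique (hC : W.ConditionC) {ν ν' : ℕ → Fin d → ℝ}
    (h : W.IsStationaryDistribution ν) (h' : W.IsStationaryDistribution ν') : ν = ν' := by
  obtain ⟨h0, h1, h2⟩ := isStationaryDistribution_iff.1 h
  obtain ⟨h0', h1', h2'⟩ := isStationaryDistribution_iff.1 h'
  have heq := h2.unique (kernelIrreducible hC) W.tsum_kernel_row h2' (by rw [h1]; simp)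
    (h1.trans h1'.symm)
  funext n i
  exact (ENNReal.ofReal_eq_ofReal_iff (h0 _ _) (h0' _ _)).1 (congrFun heq (n, i))

end StripWalk

/-! ### The explicit weights are the excursion measure -/

namespace StripWalk

variable {d : ℕ} {W : StripWalk d} {ρ : Matrix (Fin d) (Fin d) ℝ} {μ : Fin d → ℝ}

/-- The measure `μ, μ P_0 ũ⁻_1, μ P_0 A⁻_1 ũ⁻_2, …` on the layers of the half-strip. -/
noncomputable def weight (W : StripWalk d) (ρ : Matrix (Fin d) (Fin d) ℝ) (μ : Fin d → ℝ) :
    ℕ → Fin d → ℝ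
  | 0 => μ
  | n + 1 => μ ᵥ* (W.P 0 * W.prodA ρ n * W.uTilde ρ (n + 1))

theorem P_zero_mul_prodA_nonneg (hC : W.ConditionC) (hρ : ρ ∈ Matrix.rowStochastic ℝ (Fin d))
    (n : ℕ) (i j : Fin d) : 0 ≤ (W.P 0 * W.prodA ρ n) i j :=
  Matrix.mul_entry_nonneg (W.P_nonneg' 0) (prodA_nonneg hC hρ n) i j

theorem weight_nonneg (hC : W.ConditionC) (hρ : ρ ∈ Matrix.rowStochastic ℝ (Fin d))
    (hμ : 0 ≤ μ) (n : ℕ) : 0 ≤ W.weight ρ μ n := by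
  cases n with
  | zero => exact hμ
  | succ n =>
    exact Matrix.vecMul_nonneg' (Matrix.mul_entry_nonneg (P_zero_mul_prodA_nonneg hC hρ n)
      (uTilde_nonneg hC hρ (by omega))) hμ

theorem weight_vecMul_P (W : StripWalk d) (ρ : Matrix (Fin d) (Fin d) ℝ) (μ : Fin d → ℝ) (n : ℕ) :
    W.weight ρ μ n ᵥ* W.P n = μ ᵥ* (W.P 0 * W.prodA ρ n) := by
  cases n with
  | zero => simp [weight, prodA]
  | succ n => simp only [weight, prodA, A, Matrix.vecMul_vecMul, mul_assoc]

theorem weight_vecMul_Q (hC : W.ConditionC) (hρ : ρ ∈ Matrix.rowStochastic ℝ (Fin d))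
    (hfin : W.varrhoOne ρ < ⊤) (n : ℕ) : W.weight ρ μ (n + 1) ᵥ* W.Q (n + 1) =
      μ ᵥ* (W.P 0 * W.prodA ρ n * W.zeta ρ (n + 1)) := by
  rw [weight, Matrix.vecMul_vecMul, mul_assoc, uTilde_mul_Q hC hρ hfin (by omega)]

/-- The identity `ũ (1 - P ζ - R) = 1` multiplied from the left: the term with `P ζ` is the flow
from the layer above, since `ũ Q = ζ` there. -/
theorem weight_succ (hC : W.ConditionC) (hρ : ρ ∈ Matrix.rowStochastic ℝ (Fin d))
    (hfin : W.varrhoOne ρ < ⊤) (n : ℕ) : W.weight ρ μ (n + 1) =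
      W.weight ρ μ n ᵥ* W.P n + W.weight ρ μ (n + 1) ᵥ* W.R (n + 1) +
        W.weight ρ μ (n + 2) ᵥ* W.Q (n + 2) := by
  have h := Matrix.nonsing_inv_mul _ (isUnit_det_zeta hC hρ (n := n + 1) (by omega))
  rw [← uTilde, sub_sub, mul_sub, mul_one, sub_eq_iff_eq_add] at h
  rw [weight_vecMul_Q hC hρ hfin (n + 1), weight_vecMul_P, weight, Matrix.vecMul_vecMul,
    ← Matrix.vecMul_add, ← Matrix.vecMul_add]
  nth_rw 1 [h]
  congr 1
  rw [prodA, A]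
  noncomm_ring

/-- The weights as a measure with values in `[0, ∞]`. -/
noncomputable def weightMeasure (W : StripWalk d) (ρ : Matrix (Fin d) (Fin d) ℝ) (μ : Fin d → ℝ)
    (x : ℕ × Fin d) : ℝ≥0∞ :=
  ENNReal.ofReal (W.weight ρ μ x.1 x.2)

/-- The distribution `μ` on layer `0` as a measure on the half-strip. -/
noncomputable def initial (μ : Fin d → ℝ) (x : ℕ × Fin d) : ℝ≥0∞ :=
  ENNReal.ofReal (if x.1 = 0 then μ x.2 else 0)

theorem tsum_weightMeasure_succ (hC : W.ConditionC) (hρ : ρ ∈ Matrix.rowStochastic ℝ (Fin d))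
    (hfin : W.varrhoOne ρ < ⊤) (hμ : 0 ≤ μ) (n : ℕ) (j : Fin d) :
    ∑' x, W.weightMeasure ρ μ x * W.kernel x (n + 1, j) = W.weightMeasure ρ μ (n + 1, j) := by
  have h0 := weight_nonneg (μ := μ) hC hρ hμ
  rw [tsum_kernel_succ]
  simp only [weightMeasure]
  rw [← ENNReal.ofReal_vecMul (h0 n) (W.P_nonneg' n),
    ← ENNReal.ofReal_vecMul (h0 (n + 1)) (W.R_nonneg (n + 1) (by omega)),
    ← ENNReal.ofReal_vecMul (h0 (n + 2)) (W.Q_nonneg (n + 2) (by omega)),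
    ← ENNReal.ofReal_add, ← ENNReal.ofReal_add]
  · exact congrArg ENNReal.ofReal (congrFun (weight_succ hC hρ hfin n).symm j)
  · exact add_nonneg (Matrix.vecMul_nonneg' (W.P_nonneg' n) (h0 n) j)
      (Matrix.vecMul_nonneg' (W.R_nonneg (n + 1) (by omega)) (h0 (n + 1)) j)
  · exact Matrix.vecMul_nonneg' (W.Q_nonneg (n + 2) (by omega)) (h0 (n + 2)) j
  · exact Matrix.vecMul_nonneg' (W.P_nonneg' n) (h0 n) j
  · exact Matrix.vecMul_nonneg' (W.R_nonneg (n + 1) (by omega)) (h0 (n + 1)) j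

theorem tsum_weightMeasure_zero (hC : W.ConditionC) (hρ : ρ ∈ Matrix.rowStochastic ℝ (Fin d))
    (hfin : W.varrhoOne ρ < ⊤) (hμ : 0 ≤ μ) (j : Fin d) :
    ∑' x, W.weightMeasure ρ μ x * W.kernel x (0, j) =
      ENNReal.ofReal ((μ ᵥ* (W.P 0 * W.zeta ρ 1)) j) := by
  rw [tsum_kernel_zero]
  simp only [weightMeasure]
  rw [← ENNReal.ofReal_vecMul (weight_nonneg hC hρ hμ 1) (W.Q_nonneg 1 le_rfl),
    weight_vecMul_Q hC hρ hfin, prodA, mul_one]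

/-- The expected number of visits to the states of the half-strip before the return to layer `0`. -/
noncomputable def excursion (W : StripWalk d) (μ : Fin d → ℝ) : ℕ × Fin d → ℝ≥0∞ :=
  occupation W.kernel {x | x.1 = 0} (initial μ)

theorem initial_eq_zero {x : ℕ × Fin d} (hx : x ∉ {x : ℕ × Fin d | x.1 = 0}) :
    initial μ x = 0 := by
  simp only [Set.mem_ofPred_eq] at hx
  simp [initial, hx]

theorem excursion_zero (W : StripWalk d) (μ : Fin d → ℝ) (i : Fin d) :
    W.excursion μ (0, i) = ENNReal.ofReal (μ i) :=
  (occupation_of_mem (B := {x : ℕ × Fin d | x.1 = 0}) rfl).trans (by simp [initial])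

theorem excursion_le (hC : W.ConditionC) (hρ : ρ ∈ Matrix.rowStochastic ℝ (Fin d))
    (hfin : W.varrhoOne ρ < ⊤) (hμ : 0 ≤ μ) : W.excursion μ ≤ W.weightMeasure ρ μ := by
  intro x
  refine occupation_le (fun _ => initial_eq_zero) (fun z => ?_) (fun z hz => ?_) x
  · obtain ⟨n, i⟩ := z
    cases n with
    | zero => simp [initial, weightMeasure, weight]
    | succ n => simp [initial]
  · obtain ⟨n, i⟩ := z
    cases n with
    | zero => exact absurd rfl hz
    | succ n => exact (tsum_weightMeasure_succ hC hρ hfin hμ n i).le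

theorem tsum_excursion_zero (hμ : W.IsCensoredDistribution μ) (j : Fin d) :
    ∑' x, W.excursion μ x * W.kernel x (0, j) = ENNReal.ofReal (μ j) := by
  have h := tsum_occupation_mul (p := W.kernel) (B := {x : ℕ × Fin d | x.1 = 0})
    (m := initial μ) (fun _ => initial_eq_zero) ⟨(0, j), rfl⟩
  refine h.trans ?_
  rw [← hμ.invariant j, ← tsum_fintype (L := .unconditional _)]
  let e : Fin d ≃ {x : ℕ × Fin d | x.1 = 0} :=
    { toFun := fun i => ⟨(0, i), rfl⟩
      invFun := fun x => x.1.2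
      left_inv := fun i => rfl
      right_inv := fun x => Subtype.ext (Prod.ext x.2.symm rfl) }
  rw [← e.tsum_eq]
  refine tsum_congr fun i => ?_
  simp only [e, Equiv.coe_fn_mk, initial, if_true]
  rfl

/-- Minimality of the excursion measure gives `μ ≤ μ P_0 ζ_1` without identifying the censored
matrix as `P_0 ζ_1`; stochasticity of both factors makes the masses agree. -/
theorem vecMul_P_zero_mul_zeta (hC : W.ConditionC) (hρ : ρ ∈ Matrix.rowStochastic ℝ (Fin d))
    (hfin : W.varrhoOne ρ < ⊤) (hμ : W.IsCensoredDistribution μ) :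
    μ ᵥ* (W.P 0 * W.zeta ρ 1) = μ := by
  have hnn : 0 ≤ μ ᵥ* (W.P 0 * W.zeta ρ 1) :=
    Matrix.vecMul_nonneg' (Matrix.mul_entry_nonneg (W.P_nonneg' 0) (zeta_nonneg hC hρ le_rfl))
      hμ.nonneg
  have hle : ∀ j, μ j ≤ (μ ᵥ* (W.P 0 * W.zeta ρ 1)) j := by
    intro j
    rw [← ENNReal.ofReal_le_ofReal_iff (hnn j), ← tsum_excursion_zero hμ j,
      ← tsum_weightMeasure_zero hC hρ hfin hμ.nonneg j]
    exact ENNReal.tsum_le_tsum fun x => mul_le_mul_left (excursion_le hC hρ hfin hμ.nonneg x) _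
  have hsum : ∑ j, (μ ᵥ* (W.P 0 * W.zeta ρ 1)) j = ∑ j, μ j := by
    rw [← dotProduct_one, ← dotProduct_one, ← Matrix.dotProduct_mulVec, ← Matrix.mulVec_mulVec,
      zeta_mulVec_one hC hρ hfin le_rfl, (Matrix.mem_rowStochastic.1 W.P_zero_stochastic).2]
  funext j
  exact ((Finset.sum_eq_sum_iff_of_le fun j _ => hle j).1 hsum.symm j (Finset.mem_univ j)).symm

theorem weightMeasure_invariant (hC : W.ConditionC) (hρ : ρ ∈ Matrix.rowStochastic ℝ (Fin d))
    (hfin : W.varrhoOne ρ < ⊤) (hμ : W.IsCensoredDistribution μ) :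
    KernelInvariant W.kernel (W.weightMeasure ρ μ) := by
  rintro ⟨n, j⟩
  cases n with
  | zero =>
    rw [tsum_weightMeasure_zero hC hρ hfin hμ.nonneg, vecMul_P_zero_mul_zeta hC hρ hfin hμ]
    rfl
  | succ n => exact tsum_weightMeasure_succ hC hρ hfin hμ.nonneg n j

theorem excursion_invariant (hμ : W.IsCensoredDistribution μ) :
    KernelInvariant W.kernel (W.excursion μ) := by
  rintro ⟨n, j⟩
  cases n with
  | zero =>
    rw [tsum_excursion_zero hμ, excursion_zero]
  | succ n =>
    exact (occupation_of_notMem (fun _ => initial_eq_zero) (by simp)).symm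

/-- The weights minus the excursion measure form an invariant measure that vanishes on layer 0; one
such state exists because `1 ≤ d`. -/
theorem excursion_eq (hd : 1 ≤ d) (hC : W.ConditionC) (hρ : ρ ∈ Matrix.rowStochastic ℝ (Fin d))
    (hfin : W.varrhoOne ρ < ⊤) (hμ : W.IsCensoredDistribution μ) :
    W.excursion μ = W.weightMeasure ρ μ := by
  have hle := excursion_le hC hρ hfin hμ.nonneg
  have h := ((weightMeasure_invariant hC hρ hfin hμ).sub (excursion_invariant hμ) hle
    fun z => ne_top_of_le_ne_top ENNReal.ofReal_ne_top (hle z)).eq_zero (kernelIrreducible hC)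
    (x := (0, ⟨0, hd⟩)) (by
      rw [excursion_zero]
      simp [weightMeasure, weight])
  exact le_antisymm hle fun z => tsub_eq_zero_iff_le.1 (congrFun h z)

theorem tsum_weightMeasure (hC : W.ConditionC) (hρ : ρ ∈ Matrix.rowStochastic ℝ (Fin d))
    (hμ : 0 ≤ μ) : ∑' x, W.weightMeasure ρ μ x = W.varrho ρ μ := by
  have h0 := weight_nonneg (μ := μ) hC hρ hμ
  have hπ : 0 ≤ μ ᵥ* W.P 0 := Matrix.vecMul_nonneg' (W.P_nonneg' 0) hμ
  have hterm : ∀ n, ∑ i, W.weight ρ μ (n + 1) i =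
      ∑ j, (μ ᵥ* W.P 0) j * (W.prodA ρ n *ᵥ W.u ρ (n + 1)) j := by
    intro n
    rw [← dotProduct_one, weight, ← Matrix.vecMul_vecMul, ← Matrix.vecMul_vecMul,
      ← Matrix.dotProduct_mulVec, ← Matrix.dotProduct_mulVec]
    rfl
  have hsuml : ∀ n, ∑ i, ENNReal.ofReal (W.weight ρ μ n i) =
      ENNReal.ofReal (∑ i, W.weight ρ μ n i) := fun n =>
    (ENNReal.ofReal_sum_of_nonneg fun i _ => h0 n i).symm
  rw [ENNReal.summable.tsum_prod' fun _ => ENNReal.summable]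
  simp only [weightMeasure, tsum_fintype, hsuml]
  rw [tsum_eq_zero_add' ENNReal.summable, varrho, add_comm]
  congr 1
  simp only [hterm, sumAu, ← ENNReal.tsum_mul_left]
  rw [← Summable.tsum_finsetSum fun _ _ => ENNReal.summable]
  refine tsum_congr fun n => ?_
  rw [ENNReal.ofReal_sum_of_nonneg fun j _ => mul_nonneg (hπ j) (Matrix.mulVec_nonneg'
    (prodA_nonneg hC hρ n) (zero_le_one.trans (one_le_u hC hρ (by omega))) j)]
  exact Finset.sum_congr rfl fun j _ => ENNReal.ofReal_mul (hπ j)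

theorem IsCensoredDistribution.le_one (hμ : W.IsCensoredDistribution μ) : μ ≤ 1 := by
  intro i
  rw [Pi.one_apply, ← hμ.sum_eq_one]
  exact Finset.single_le_sum (fun i _ => hμ.nonneg i) (Finset.mem_univ i)

theorem varrho_drift_le (ρ : Matrix (Fin d) (Fin d) ℝ) (hμ : W.IsCensoredDistribution μ) :
    ∑ j, ENNReal.ofReal ((μ ᵥ* W.P 0) j) * W.sumAu ρ j ≤
      ∑ j, ENNReal.ofReal (((1 : Fin d → ℝ) ᵥ* W.P 0) j) * W.sumAu ρ j := by
  refine Finset.sum_le_sum fun j _ => mul_le_mul_left (ENNReal.ofReal_le_ofReal ?_) _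
  simp only [Matrix.vecMul, dotProduct]
  exact Finset.sum_le_sum fun i _ => mul_le_mul_of_nonneg_right (hμ.le_one i) (W.P_nonneg' 0 i j)

theorem varrho_le (hd : 1 ≤ d) (ρ : Matrix (Fin d) (Fin d) ℝ) (hμ : W.IsCensoredDistribution μ) :
    W.varrho ρ μ ≤ W.varrhoOne ρ := by
  refine add_le_add (varrho_drift_le ρ hμ) ?_
  rw [hμ.sum_eq_one, ENNReal.ofReal_one]
  exact_mod_cast hd

theorem varrho_lt (hd : 2 ≤ d) (hfin : W.varrhoOne ρ < ⊤) (hμ : W.IsCensoredDistribution μ) :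
    W.varrho ρ μ < W.varrhoOne ρ := by
  refine ENNReal.add_lt_add_of_le_of_lt ?_ (varrho_drift_le ρ hμ) ?_
  · exact ne_top_of_le_ne_top hfin.ne ((varrho_drift_le ρ hμ).trans le_self_add)
  · rw [hμ.sum_eq_one, ENNReal.ofReal_one]
    exact_mod_cast hd

theorem isStationaryDistribution_weight (hC : W.ConditionC)
    (hρ : ρ ∈ Matrix.rowStochastic ℝ (Fin d)) (hfin : W.varrhoOne ρ < ⊤)
    (hμ : W.IsCensoredDistribution μ) (htop : W.varrho ρ μ ≠ ⊤) :
    W.IsStationaryDistribution fun n => (W.varrho ρ μ).toReal⁻¹ • W.weight ρ μ n := by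
  have hc : 0 ≤ (W.varrho ρ μ).toReal⁻¹ := inv_nonneg.2 ENNReal.toReal_nonneg
  have hne : W.varrho ρ μ ≠ 0 := by
    rw [varrho, hμ.sum_eq_one, ENNReal.ofReal_one]
    exact (lt_of_lt_of_le zero_lt_one le_add_self).ne'
  have hmul : ∀ x : ℕ × Fin d, ENNReal.ofReal (((W.varrho ρ μ).toReal⁻¹ • W.weight ρ μ x.1) x.2) =
      (W.varrho ρ μ)⁻¹ * W.weightMeasure ρ μ x := by
    intro x
    rw [Pi.smul_apply, smul_eq_mul, ENNReal.ofReal_mul hc, ← ENNReal.toReal_inv,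
      ENNReal.ofReal_toReal (ENNReal.inv_ne_top.2 hne)]
    rfl
  refine isStationaryDistribution_iff.2 ⟨fun n i => ?_, ?_, fun z => ?_⟩
  · exact mul_nonneg hc (weight_nonneg hC hρ hμ.nonneg n i)
  · simp only [hmul]
    rw [ENNReal.tsum_mul_left, tsum_weightMeasure hC hρ hμ.nonneg, ENNReal.inv_mul_cancel hne htop]
  · simp only [hmul, mul_assoc]
    rw [ENNReal.tsum_mul_left, weightMeasure_invariant hC hρ hfin hμ z]

end StripWalk

/-! ### The mean return time -/

section ReturnTime

open MeasureTheory

/-- The tail formula `T = ∑_t 1{T > t}`; the set for `t = 0` is the whole space. -/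
theorem returnTime_eq_tsum {d : ℕ} {Ω : Type*} (X : ℕ → Ω → ℕ × Fin d) (ω : Ω) :
    returnTime X ω = ∑' t : ℕ, {ω | ∀ s, 1 ≤ s → s ≤ t → (X s ω).1 ≠ 0}.indicator 1 ω := by
  classical
  by_cases h : ∃ t, 1 ≤ t ∧ (X t ω).1 = 0
  · have hlt : ∀ t, ω ∈ {ω | ∀ s, 1 ≤ s → s ≤ t → (X s ω).1 ≠ 0} ↔ t < Nat.find h := by
      intro t
      rw [Nat.lt_find_iff]
      simp only [Set.mem_ofPred_eq, not_and]
      exact ⟨fun h s hs h1 => h s h1 hs, fun h s h1 hs => h s hs h1⟩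
    have h1 : returnTime X ω = (Nat.find h : ℝ≥0∞) := by
      refine le_antisymm (iInf₂_le (Nat.find h) (Nat.find_spec h)) (le_iInf₂ fun t ht => ?_)
      exact_mod_cast Nat.find_min' h ht
    rw [h1, tsum_eq_sum (s := Finset.range (Nat.find h))]
    · rw [Finset.sum_congr rfl fun t ht =>
        Set.indicator_of_mem ((hlt t).2 (Finset.mem_range.1 ht)) 1]
      simp
    · intro t ht
      exact Set.indicator_of_notMem (fun h' => ht (Finset.mem_range.2 ((hlt t).1 h'))) _
  · push Not at h
    have h1 : returnTime X ω = ⊤ := by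
      simp only [returnTime, iInf_eq_top]
      exact fun t ht => absurd ht.2 (h t ht.1)
    rw [h1, eq_comm, tsum_congr (g := fun _ : ℕ => (1 : ℝ≥0∞))]
    · exact ENNReal.tsum_const_eq_top_of_ne_zero one_ne_zero
    · intro t
      have hmem : ω ∈ {ω | ∀ s, 1 ≤ s → s ≤ t → (X s ω).1 ≠ 0} := fun s hs _ => h s hs
      exact Set.indicator_of_mem hmem 1

namespace StripWalk

variable {d : ℕ} {W : StripWalk d} {μ : Fin d → ℝ} {Ω : Type*} [MeasurableSpace Ω]
  {ℙ : Measure Ω} {X : ℕ → Ω → ℕ × Fin d}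

theorem IsWalkFrom.measure_history_and_next (hX : W.IsWalkFrom ℙ X μ) (t : ℕ)
    (b : Fin (t + 1) → ℕ × Fin d) (z : ℕ × Fin d) :
    ℙ ({ω | (fun s : Fin (t + 1) => X s ω) = b} ∩ {ω | X (t + 1) ω = z}) =
      ℙ {ω | (fun s : Fin (t + 1) => X s ω) = b} * W.kernel (b (Fin.last t)) z := by
  let x : ℕ → ℕ × Fin d := fun s => if h : s < t + 1 then b ⟨s, h⟩ else z
  have hx : ∀ s (h : s < t + 1), x s = b ⟨s, h⟩ := fun s h => dif_pos h
  have hx' : x (t + 1) = z := dif_neg (lt_irrefl _)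
  have h1 : {ω | (fun s : Fin (t + 1) => X s ω) = b} = {ω | ∀ s ≤ t, X s ω = x s} := by
    ext ω
    simp only [Set.mem_ofPred_eq, funext_iff]
    constructor
    · intro h s hs
      rw [hx s (by omega)]
      exact h ⟨s, by omega⟩
    · intro h s
      rw [h s (by omega), hx s s.2]
  have h2 : {ω | (fun s : Fin (t + 1) => X s ω) = b} ∩ {ω | X (t + 1) ω = z} =
      {ω | ∀ s ≤ t + 1, X s ω = x s} := by
    rw [h1]
    ext ω
    simp only [Set.mem_inter_iff, Set.mem_ofPred_eq]
    constructor
    · rintro ⟨h, h'⟩ s hs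
      rcases Nat.lt_or_ge s (t + 1) with hlt | hge
      · exact h s (by omega)
      · obtain rfl : s = t + 1 := by omega
        rw [h', hx']
    · exact fun h => ⟨fun s hs => h s (by omega), (h (t + 1) le_rfl).trans hx'⟩
  rw [h2, h1, hX.law, hX.law, Finset.prod_range_succ, ← mul_assoc, mul_comm,
    ENNReal.ofReal_mul (W.step_nonneg _ _), mul_comm, hx', hx t (by omega)]
  rfl

theorem IsWalkFrom.measurable_history (hX : W.IsWalkFrom ℙ X μ) (t : ℕ) :
    Measurable fun ω => fun s : Fin (t + 1) => X s ω :=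
  measurable_pi_lambda _ fun s => hX.measurable s

/-- The Markov property for events that the states up to time `t` determine. -/
theorem IsWalkFrom.measure_inter_next (hX : W.IsWalkFrom ℙ X μ) (t : ℕ)
    (B : Set (Fin (t + 1) → ℕ × Fin d)) (y z : ℕ × Fin d) (hB : ∀ b ∈ B, b (Fin.last t) = y) :
    ℙ ((fun ω => fun s : Fin (t + 1) => X s ω) ⁻¹' B ∩ {ω | X (t + 1) ω = z}) =
      ℙ ((fun ω => fun s : Fin (t + 1) => X s ω) ⁻¹' B) * W.kernel y z := by
  have hms : ∀ b ∈ B, MeasurableSet ((fun ω => fun s : Fin (t + 1) => X s ω) ⁻¹' {b}) :=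
    fun b _ => hX.measurable_history t (measurableSet_singleton b)
  have hz : MeasurableSet {ω | X (t + 1) ω = z} :=
    hX.measurable (t + 1) (measurableSet_singleton z)
  -- There are countably many histories; decompose `B` into them, all ending at `y`, so that the
  -- last transition probability factors out.
  rw [← Measure.restrict_apply' hz, ← tsum_measure_preimage_singleton B.to_countable hms,
    ← tsum_measure_preimage_singleton B.to_countable hms, ← ENNReal.tsum_mul_right]
  refine tsum_congr fun b => ?_
  rw [Measure.restrict_apply' hz, ← hB b b.2]
  exact hX.measure_history_and_next t b z

theorem IsWalkFrom.measurableSet_avoid (hX : W.IsWalkFrom ℙ X μ) (t : ℕ) :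
    MeasurableSet {ω | ∀ s, 1 ≤ s → s ≤ t → (X s ω).1 ≠ 0} := by
  simp only [Set.ofPred_forall]
  exact .iInter fun s => .iInter fun _ => .iInter fun _ =>
    hX.measurable s (Set.to_countable {x : ℕ × Fin d | x.1 ≠ 0}).measurableSet

theorem IsWalkFrom.measure_avoid_eq_taboo (hX : W.IsWalkFrom ℙ X μ) (t : ℕ) (z : ℕ × Fin d) :
    ℙ ({ω | ∀ s, 1 ≤ s → s ≤ t → (X s ω).1 ≠ 0} ∩ {ω | X t ω = z}) =
      taboo W.kernel {x | x.1 = 0}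
        (initial μ) t z := by
  induction t generalizing z with
  | zero =>
    have h := hX.law 0 fun _ => z
    simp only [Finset.range_zero, Finset.prod_empty, mul_one] at h
    rw [taboo, initial, ← h]
    congr 1
    ext ω
    simp only [Set.mem_inter_iff, Set.mem_ofPred_eq]
    refine ⟨fun h s hs => ?_, fun h => ⟨fun s _ _ => by omega, h 0 le_rfl⟩⟩
    obtain rfl : s = 0 := by omega
    exact h.2
  | succ t ih =>
    simp only [taboo]
    split_ifs with hz
    · rw [show {ω | ∀ s, 1 ≤ s → s ≤ t + 1 → (X s ω).1 ≠ 0} ∩ {ω | X (t + 1) ω = z} = ∅ from ?_,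
        measure_empty]
      refine Set.eq_empty_of_forall_notMem fun ω hω => ?_
      have h := hω.1 (t + 1) (by omega) le_rfl
      rw [hω.2] at h
      exact h hz
    · have hset : {ω | ∀ s, 1 ≤ s → s ≤ t + 1 → (X s ω).1 ≠ 0} ∩ {ω | X (t + 1) ω = z} =
          {ω | ∀ s, 1 ≤ s → s ≤ t → (X s ω).1 ≠ 0} ∩ {ω | X (t + 1) ω = z} := by
        ext ω
        simp only [Set.mem_inter_iff, Set.mem_ofPred_eq]
        refine ⟨fun h => ⟨fun s h1 h2 => h.1 s h1 (by omega), h.2⟩,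
          fun h => ⟨fun s h1 h2 => ?_, h.2⟩⟩
        rcases Nat.lt_or_ge s (t + 1) with hlt | hge
        · exact h.1 s h1 (by omega)
        · obtain rfl : s = t + 1 := by omega
          rw [h.2]
          exact hz
      have hm : MeasurableSet ({ω | ∀ s, 1 ≤ s → s ≤ t → (X s ω).1 ≠ 0} ∩
          {ω | X (t + 1) ω = z}) := by
        refine MeasurableSet.inter ?_ (hX.measurable (t + 1) (measurableSet_singleton z))
        exact hX.measurableSet_avoid t
      have hsum := tsum_measure_preimage_singleton (f := X t) (s := Set.univ)
        (μ := ℙ.restrict ({ω | ∀ s, 1 ≤ s → s ≤ t → (X s ω).1 ≠ 0} ∩ {ω | X (t + 1) ω = z}))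
        (Set.to_countable _) fun y _ => hX.measurable t (measurableSet_singleton y)
      rw [Set.preimage_univ, Measure.restrict_apply' hm, Set.univ_inter,
        tsum_univ (f := fun y => ℙ.restrict _ (X t ⁻¹' {y}))] at hsum
      rw [hset, ← hsum]
      refine tsum_congr fun y => ?_
      rw [← ih y, Measure.restrict_apply' hm]
      -- The avoidance event with last state `y`, written as an event of the history so that the
      -- Markov property applies.
      let B : Set (Fin (t + 1) → ℕ × Fin d) :=
        {b | (∀ s : Fin (t + 1), 1 ≤ (s : ℕ) → (b s).1 ≠ 0) ∧ b (Fin.last t) = y}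
      have hpre : (fun ω => fun s : Fin (t + 1) => X s ω) ⁻¹' B =
          {ω | ∀ s, 1 ≤ s → s ≤ t → (X s ω).1 ≠ 0} ∩ {ω | X t ω = y} := by
        ext ω
        simp only [B, Set.mem_preimage, Set.mem_ofPred_eq, Set.mem_inter_iff, Fin.val_last]
        exact and_congr_left fun _ => ⟨fun h s h1 h2 => h ⟨s, by omega⟩ h1,
          fun h s h1 => h s h1 (by omega)⟩
      rw [← hpre, ← hX.measure_inter_next t B y z fun b hb => hb.2, hpre]
      congr 1
      ext ω
      simp only [Set.mem_inter_iff, Set.mem_preimage, Set.mem_singleton_iff, Set.mem_ofPred_eq]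
      tauto

/-- Integrate the tail formula: the probability of avoiding layer 0 through time `t` is the total
mass of the taboo measure at time `t`. -/
theorem IsWalkFrom.lintegral_returnTime (hX : W.IsWalkFrom ℙ X μ) :
    ∫⁻ ω, returnTime X ω ∂ℙ = ∑' x, W.excursion μ x := by
  simp only [returnTime_eq_tsum, excursion, occupation]
  rw [lintegral_tsum fun t =>
    (measurable_one.indicator (hX.measurableSet_avoid t)).aemeasurable, ENNReal.tsum_comm]
  refine tsum_congr fun t => ?_
  rw [lintegral_indicator_one (hX.measurableSet_avoid t)]
  simp only [← hX.measure_avoid_eq_taboo]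
  have hsum := tsum_measure_preimage_singleton (f := X t) (s := Set.univ)
    (μ := ℙ.restrict {ω | ∀ s, 1 ≤ s → s ≤ t → (X s ω).1 ≠ 0})
    (Set.to_countable _) fun y _ => hX.measurable t (measurableSet_singleton y)
  rw [Set.preimage_univ, Measure.restrict_apply' (hX.measurableSet_avoid t), Set.univ_inter,
    tsum_univ (f := fun y => ℙ.restrict _ (X t ⁻¹' {y}))] at hsum
  rw [← hsum]
  refine tsum_congr fun y => ?_
  rw [Measure.restrict_apply' (hX.measurableSet_avoid t), Set.inter_comm]
  rfl

end StripWalk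

end ReturnTime

theorem theorem3 {d : ℕ} (hd : 1 ≤ d) (W : StripWalk d) (hC : W.ConditionC)
    (ρ : Matrix (Fin d) (Fin d) ℝ) (hρ : ρ ∈ Matrix.rowStochastic ℝ (Fin d))
    (hfin : W.varrhoOne ρ < ⊤)
    (μ : Fin d → ℝ) (hμ : W.IsCensoredDistribution μ) :
    -- the lower limits that define the matrices `ζ⁻_n` are limits
    (∀ n, 1 ≤ n → ∀ i j,
      Tendsto (fun m => W.zetaTrunc ρ n m i j) atTop (nhds (W.zeta ρ n i j))) ∧
    -- existence and uniqueness
    (∃! ν : ℕ → Fin d → ℝ, W.IsStationaryDistribution ν) ∧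
    -- the explicit form
    (∀ ν : ℕ → Fin d → ℝ, W.IsStationaryDistribution ν →
      (∀ n, 1 ≤ n → ν n = (W.varrho ρ μ).toReal⁻¹ •
        (μ ᵥ* (W.P 0 * W.prodA ρ (n - 1) * W.uTilde ρ n))) ∧
      ν 0 = (W.varrho ρ μ).toReal⁻¹ • μ) ∧
    -- the normalizing constant
    W.varrho ρ μ ≤ W.varrhoOne ρ ∧
    (2 ≤ d → W.varrho ρ μ < W.varrhoOne ρ) ∧
    (∀ {Ω : Type*} [MeasurableSpace Ω] (ℙ : MeasureTheory.Measure Ω)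
      [MeasureTheory.IsProbabilityMeasure ℙ] (X : ℕ → Ω → ℕ × Fin d),
      W.IsWalkFrom ℙ X μ → ∫⁻ ω, returnTime X ω ∂ℙ = W.varrho ρ μ) := by
  have hle := StripWalk.varrho_le hd ρ hμ
  have hν := StripWalk.isStationaryDistribution_weight hC hρ hfin hμ (hle.trans_lt hfin).ne
  refine ⟨fun n hn i j => StripWalk.tendsto_zetaTrunc hC hρ hfin hn i j,
    ⟨_, hν, fun ν h => h.unique hC hν⟩, fun ν h => ?_, hle,
    fun h2 => StripWalk.varrho_lt h2 hfin hμ, fun ℙ _ X hX => ?_⟩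
  · rw [h.unique hC hν]
    refine ⟨fun n hn => ?_, rfl⟩
    obtain ⟨k, rfl⟩ : ∃ k, n = k + 1 := ⟨n - 1, by omega⟩
    rfl
  · rw [hX.lintegral_returnTime, StripWalk.excursion_eq hd hC hρ hfin hμ,
      StripWalk.tsum_weightMeasure hC hρ hμ.nonneg]
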